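/- A *DQD-algebra* (dually quasi-De Morgan semi-Heyting algebra) is an algebra $\mathbf L=\langle L,\vee,\wedge,\to,{}',0,1\rangle$ such that $\langle L,\vee,\wedge,0,1\rangle$ is a bounded lattice and the following hold: $x\wedge(x\to y)\approx x\wedge y$; $x\wedge(y\to z)\approx x\wedge[(x\wedge y)\to(x\wedge z)]$; $x\to x\approx 1$; $0'\approx 1$; $1'\approx 0$; $(x\wedge y)'\approx x'\vee y'$; $(x\vee y)''\approx x''\vee y''$; $x''\le x$. Put $x^*:=x\to 0$ and $x^+:=x'{}^*{}'$. Let $\mathbf{JIDL_1}$ be the variety of all DQD-algebras that satisfy $$x'\vee(y\to z)\approx(x'\vee y)\to(x'\vee z),\qquad (x\to y)\vee(y\to x)\approx 1,\qquad x\wedge x'{}^*\approx x\wedge x'{}^*\wedge x'{}^*{}'{}^*.$$ A variety of DQD-algebras is a class closed under homomorphic images, subalgebras (and their isomorphic copies) and direct products; $\mathbf{V}(K)$ is the least variety containing $K$, and $\vee$ between varieties denotes their join. "A class is defined, modulo $\mathbf{JIDL_1}$, by some identities" means that it consists exactly of the members of $\mathbf{JIDL_1}$ that satisfy them. For $n\ge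 1$ let $\mathbf{C_n^{dp}}$ be the $n$-element chain with its Heyting implication ($x\to y=1$ if $x\le y$, and $x\to y=y$ otherwise) and with $1'=0$ and $x'=1$ for $x\ne 1$. Let $\mathbf{D_2}$ be the four-element Boolean algebra $\{0,a,b,1\}$ with its Boolean implication and $0'=1$, $1'=0$, $a'=a$, $b'=b$. Let $\mathbf{DStHC}$ be the variety generated by the DQD-algebras whose lattice reduct is a chain and which satisfy $(x\wedge y)\to y\approx 1$ and $x'\wedge x''\approx 0$ (the dually Stone Heyting chains). For $n\ge 1$ let $$(\mathrm C_n)\qquad x_1\vee\cdots\vee x_n\vee(x_1\to x_2)\vee(x_2\to x_3)\vee\cdots\vee(x_{n-1}\to x_n)\approx 1 .$$ Then: 1. $\mathbf{DStHC}$ is defined, modulo $\mathbf{JIDL_1}$, by $x\vee x'\approx 1$. 2. $\mathbf{V}(\mathbf{D_2})$ is defined, modulo $\mathbf{JIDL_1}$, by $x''\approx x$. 3. For every $n\ge 2$, $\mathbf{V}(\mathbf{C_n^{dp}})\vee\mathbf{V}(\mathbf{D_2})$ is defined, modulo $\mathbf{JIDL_1}$, by $(\mathrm C_n)$. 4. For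 every $n\ge 1$, $\mathbf{V}(\mathbf{C_n^{dp}})$ is defined, modulo $\mathbf{JIDL_1}$, by $x\vee x'\approx 1$ and $(\mathrm C_n)$. 5. These cover all subvarieties: every subvariety of $\mathbf{JIDL_1}$ is one of $\mathbf{JIDL_1}$, $\mathbf{DStHC}$, $\mathbf{V}(\mathbf{D_2})$, $\mathbf{V}(\mathbf{C_n^{dp}})$ for some $n\ge 1$, or $\mathbf{V}(\mathbf{C_n^{dp}})\vee\mathbf{V}(\mathbf{D_2})$ for some $n\ge 2$. 6. $\mathbf{V}(\mathbf{C_3^{dp}})\vee\mathbf{V}(\mathbf{D_2})$ is defined, modulo $\mathbf{JIDL_1}$, by regularity, $x\wedge x^+\le y\vee y^*$; it is also defined, modulo $\mathbf{JIDL_1}$, by $x\wedge x'\le y\vee y^*$. 7. $\mathbf{V}(\mathbf{C_3^{dp}})$ is defined, modulo $\mathbf{JIDL_1}$, by regularity, $x\wedge x^+\le y\vee y^*$, together with $x'\approx x^+$. -/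

import Mathlib

universe u v w

/-- A dually quasi-De Morgan semi-Heyting algebra (a DQD-algebra)
`⟨L, ∨, ∧, →, ′, 0, 1⟩`. The implication is written `x ⇨ y`, the unary operation is `prime x`.
One-element algebras are allowed. -/
class DQDAlgebra (L : Type u) extends Lattice L, BoundedOrder L, HImp L where
  /-- the dual quasi-De Morgan operation -/
  prime : L → L
  inf_imp : ∀ x y : L, x ⊓ (x ⇨ y) = x ⊓ y
  inf_imp_eq : ∀ x y z : L, x ⊓ (y ⇨ z) = x ⊓ ((x ⊓ y) ⇨ (x ⊓ z))
  imp_self_eq : ∀ x : L, x ⇨ x = ⊤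
  prime_bot : prime ⊥ = ⊤
  prime_top : prime ⊤ = ⊥
  prime_inf : ∀ x y : L, prime (x ⊓ y) = prime x ⊔ prime y
  prime_prime_sup : ∀ x y : L, prime (prime (x ⊔ y)) = prime (prime x) ⊔ prime (prime y)
  prime_prime_le : ∀ x : L, prime (prime x) ≤ x

/-- Bundled DQD-algebras; a class of DQD-algebras is a `Set DQDAlg`. -/
structure DQDAlg : Type (u + 1) where
  carrier : Type u
  [str : DQDAlgebra carrier]

namespace DQDAlg

instance : CoeSort DQDAlg.{u} (Type u) := ⟨carrier⟩

attribute [instance] DQDAlg.str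

/-! ### Operations and identities -/

section Operations

variable {L : Type u} [DQDAlgebra L]

/-- The operation `x′`. -/
def prime (x : L) : L := DQDAlgebra.prime x

/-- The pseudocomplement `x* := x → 0`. -/
def pcompl (x : L) : L := x ⇨ ⊥

/-- `x⁺ := x′*′`. -/
def plus (x : L) : L := prime (pcompl (prime x))

/-- `x ^ n(′*)`: the operation `x ↦ x′*` iterated `n` times. -/
def iterPrimeStar : ℕ → L → L
  | 0, x => x
  | n + 1, x => pcompl (prime (iterPrimeStar n x))

/-- The terms `t₀(x) = x`, `t_{n+1}(x) = t_n(x) ∧ x^{(n+1)(′*)}`. -/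
def levelTerm : ℕ → L → L
  | 0, x => x
  | n + 1, x => levelTerm n x ⊓ iterPrimeStar (n + 1) x

end Operations

/-- Level `n`: `t_n(x) ≈ t_{n+1}(x)`. -/
def HasLevel (A : DQDAlg.{u}) (n : ℕ) : Prop :=
  ∀ x : A, levelTerm n x = levelTerm (n + 1) x

/-- The JI-distributive identity (restricted distribution of join over implication). -/
def IsJID (A : DQDAlg.{u}) : Prop :=
  ∀ x y z : A, prime x ⊔ (y ⇨ z) = (prime x ⊔ y) ⇨ (prime x ⊔ z)

/-- The linear identity. -/
def IsLinear (A : DQDAlg.{u}) : Prop :=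
  ∀ x y : A, (x ⇨ y) ⊔ (y ⇨ x) = ⊤

/-- The semi-Heyting reduct is a Heyting algebra. -/
def IsHeyting (A : DQDAlg.{u}) : Prop :=
  ∀ x y : A, (x ⊓ y) ⇨ y = ⊤

/-- The dual Stone identity. -/
def IsDuallyStone (A : DQDAlg.{u}) : Prop :=
  ∀ x : A, prime x ⊓ prime (prime x) = ⊥

/-- The lattice reduct is a chain. -/
def IsChainAlg (A : DQDAlg.{u}) : Prop :=
  ∀ x y : A, x ≤ y ∨ y ≤ x

/-- The identity
`x₁ ∨ ⋯ ∨ xₙ ∨ (x₁ → x₂) ∨ ⋯ ∨ (xₙ₋₁ → xₙ) ≈ 1`; only `x 1, …, x n` matter. -/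
def SatisfiesC (n : ℕ) (A : DQDAlg.{u}) : Prop :=
  ∀ x : ℕ → A,
    (Finset.Icc 1 n).sup x ⊔ (Finset.Ico 1 n).sup (fun i => x i ⇨ x (i + 1)) = ⊤

/-! ### Homomorphisms, products, varieties -/

/-- Homomorphisms of DQD-algebras. -/
structure IsHom {A : DQDAlg.{u}} {B : DQDAlg.{v}} (f : A → B) : Prop where
  map_sup : ∀ x y : A, f (x ⊔ y) = f x ⊔ f y
  map_inf : ∀ x y : A, f (x ⊓ y) = f x ⊓ f y
  map_imp : ∀ x y : A, f (x ⇨ y) = f x ⇨ f y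
  map_prime : ∀ x : A, f (prime x) = prime (f x)
  map_bot : f ⊥ = ⊥
  map_top : f ⊤ = ⊤

/-- Isomorphic algebras (possibly in different universes). -/
def Iso (A : DQDAlg.{u}) (B : DQDAlg.{v}) : Prop :=
  ∃ f : A → B, IsHom f ∧ Function.Bijective f

/-- The direct product, with coordinatewise operations. -/
def pi {ι : Type w} (A : ι → DQDAlg.{u}) : DQDAlg.{max u w} where
  carrier := ∀ i, A i
  str :=
    { toLattice := inferInstance
      toBoundedOrder := inferInstance
      himp := fun x y i => x i ⇨ y i
      prime := fun x i => DQDAlgebra.prime (x i)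
      inf_imp := fun x y => funext fun i => DQDAlgebra.inf_imp (x i) (y i)
      inf_imp_eq := fun x y z => funext fun i => DQDAlgebra.inf_imp_eq (x i) (y i) (z i)
      imp_self_eq := fun x => funext fun i => DQDAlgebra.imp_self_eq (x i)
      prime_bot := funext fun _ => DQDAlgebra.prime_bot
      prime_top := funext fun _ => DQDAlgebra.prime_top
      prime_inf := fun x y => funext fun i => DQDAlgebra.prime_inf (x i) (y i)
      prime_prime_sup := fun x y => funext fun i => DQDAlgebra.prime_prime_sup (x i) (y i)
      prime_prime_le := fun x i => DQDAlgebra.prime_prime_le (x i) }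

/-- A variety of DQD-algebras: a class closed under homomorphic images, (isomorphic copies of)
subalgebras, and direct products of arbitrary families, including the empty one. -/
structure IsVariety (𝒱 : Set DQDAlg.{u}) : Prop where
  image : ∀ A B : DQDAlg.{u}, A ∈ 𝒱 → ∀ f : A → B, IsHom f → Function.Surjective f → B ∈ 𝒱
  sub : ∀ A B : DQDAlg.{u}, A ∈ 𝒱 → ∀ f : B → A, IsHom f → Function.Injective f → B ∈ 𝒱
  prod : ∀ (ι : Type u) (A : ι → DQDAlg.{u}), (∀ i, A i ∈ 𝒱) → pi A ∈ 𝒱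

/-- `V(K)`, the variety generated by `K`: the least variety that contains `K`. -/
def generated (K : Set DQDAlg.{u}) : Set DQDAlg.{u} :=
  ⋂₀ {𝒱 | IsVariety 𝒱 ∧ K ⊆ 𝒱}

/-- The variety generated by a single algebra `B`; `B` may live in another universe, so we
generate by its isomorphic copies. -/
def generatedBy (B : DQDAlg.{v}) : Set DQDAlg.{u} :=
  generated {A | Iso A B}

/-- The join of two varieties. -/
def join (𝒱 𝒲 : Set DQDAlg.{u}) : Set DQDAlg.{u} := generated (𝒱 ∪ 𝒲)

theorem isVariety_generated (K : Set DQDAlg.{u}) : IsVariety (generated K) where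
  image A B hA f hf hs := fun 𝒱 h𝒱 => h𝒱.1.image A B (hA 𝒱 h𝒱) f hf hs
  sub A B hA f hf hi := fun 𝒱 h𝒱 => h𝒱.1.sub A B (hA 𝒱 h𝒱) f hf hi
  prod ι A hA := fun 𝒱 h𝒱 => h𝒱.1.prod ι A fun i => hA i 𝒱 h𝒱

theorem subset_generated (K : Set DQDAlg.{u}) : K ⊆ generated K :=
  fun _ hA _ h𝒱 => h𝒱.2 hA

/-! ### The algebras and the varieties -/

/-- `C_n^dp`: the `n`-element chain with its Heyting implication and the dual pseudocomplement,
`1′ = 0` and `x′ = 1` for `x ≠ 1`. -/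
noncomputable def chainDP (n : ℕ) [NeZero n] : DQDAlg.{0} where
  carrier := Fin n
  str :=
    { toLattice := Fin.instLattice
      toBoundedOrder := inferInstance
      himp := fun x y => if x ≤ y then ⊤ else y
      prime := fun x => if x = ⊤ then ⊥ else ⊤
      inf_imp := by
        intro x y
        show x ⊓ (if x ≤ y then ⊤ else y) = x ⊓ y
        split_ifs with h
        · simp [h]
        · rfl
      inf_imp_eq := by
        intro x y z
        show x ⊓ (if y ≤ z then ⊤ else z) = x ⊓ (if x ⊓ y ≤ x ⊓ z then ⊤ else x ⊓ z)
        rcases le_total x z with hxz | hxz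
        · have h2 : x ⊓ y ≤ x ⊓ z := le_inf inf_le_left (inf_le_left.trans hxz)
          rw [if_pos h2]
          split_ifs <;> simp [hxz]
        · by_cases h : y ≤ z
          · rw [if_pos h, if_pos (inf_le_inf_left x h)]
          · rw [if_neg h]
            split_ifs with h2
            · have : x ≤ z := by
                rcases le_total x y with hxy | hxy
                · exact (le_inf le_rfl hxy).trans (h2.trans inf_le_right)
                · exact absurd ((le_inf hxy le_rfl).trans (h2.trans inf_le_right)) h
              simp [this]
            · simp
      imp_self_eq := by
        intro x
        show (if x ≤ x then ⊤ else x) = ⊤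
        simp
      prime_bot := by
        show (if (⊥ : Fin n) = ⊤ then (⊥ : Fin n) else ⊤) = ⊤
        split_ifs with h <;> simp [h]
      prime_top := by
        show (if (⊤ : Fin n) = ⊤ then (⊥ : Fin n) else ⊤) = ⊥
        simp
      prime_inf := by
        intro x y
        show (if x ⊓ y = ⊤ then (⊥ : Fin n) else ⊤) =
          (if x = ⊤ then ⊥ else ⊤) ⊔ (if y = ⊤ then ⊥ else ⊤)
        by_cases hx : x = ⊤ <;> by_cases hy : y = ⊤ <;> simp [hx, hy, inf_eq_top_iff]
      prime_prime_sup := by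
        have key : ∀ x : Fin n, (if (if x = ⊤ then (⊥ : Fin n) else ⊤) = ⊤ then (⊥ : Fin n) else ⊤)
            = if x = ⊤ then ⊤ else ⊥ := by
          intro x
          by_cases hx : x = ⊤
          · by_cases h : (⊥ : Fin n) = ⊤ <;> simp [hx, h]
          · simp [hx]
        have top_sup : ∀ x y : Fin n, x ⊔ y = ⊤ ↔ x = ⊤ ∨ y = ⊤ := by
          intro x y
          constructor
          · intro h
            rcases le_total x y with hxy | hxy
            · right; rwa [sup_eq_right.2 hxy] at h
            · left; rwa [sup_eq_left.2 hxy] at h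
          · rintro (h | h) <;> simp [h]
        intro x y
        refine (key (x ⊔ y)).trans (Eq.trans ?_ (congrArg₂ (· ⊔ ·) (key x) (key y)).symm)
        by_cases hx : x = ⊤ <;> by_cases hy : y = ⊤ <;> simp [hx, hy, top_sup]
      prime_prime_le := by
        intro x
        show (if (if x = ⊤ then (⊥ : Fin n) else ⊤) = ⊤ then (⊥ : Fin n) else ⊤) ≤ x
        by_cases hx : x = ⊤ <;> simp [hx] }

/-- `D₂`: the four-element Boolean lattice `{0, a, b, 1}`, realised as pairs of truth values with
`a = (1, 0)` and `b = (0, 1)`, with its Boolean implication and with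
`0′ = 1`, `1′ = 0`, `a′ = a`, `b′ = b`. -/
def algD2 : DQDAlg.{0} where
  carrier := Bool × Bool
  str :=
    { toLattice := @Prod.instLattice Bool Bool DistribLattice.toLattice DistribLattice.toLattice
      toBoundedOrder := inferInstance
      himp := fun x y => (!x.1 || y.1, !x.2 || y.2)
      prime := fun x => (!x.2, !x.1)
      inf_imp := by decide
      inf_imp_eq := by decide
      imp_self_eq := by decide
      prime_bot := by decide
      prime_top := by decide
      prime_inf := by decide
      prime_prime_sup := by decide
      prime_prime_le := by decide }

/-- `JIDL₁`: the JI-distributive, linear DQD-algebras of level 1. -/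
def JIDL1 : Set DQDAlg.{u} :=
  {A | IsJID A ∧ IsLinear A ∧ HasLevel A 1}

/-- `DStHC`: the variety generated by the dually Stone Heyting chains. -/
def DStHC : Set DQDAlg.{u} :=
  generated {A | IsDuallyStone A ∧ IsHeyting A ∧ IsChainAlg A}

end DQDAlg

/-! Every algebra in `JIDL1` embeds in a product of quotients, each of which is a Heyting chain with
dual pseudocomplement or `D₂` (`exists_separating_hom`). Linearity forces the reduct to be Heyting,
and JI-distributivity makes every `x′` complemented. It follows that `′` is dually De Morgan and
that `″` is an idempotent bounded lattice endomorphism, so distinct elements are separated by a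
prime filter `Q` compatible with `″`. Such a `Q` has a twin `{x | x′ ∉ Q}`. If `Q` is its own twin,
factoring by `Q` gives a chain on which `′` is the dual pseudocomplement. If not, level one makes
both filters maximal, and together they define a map onto `D₂`.

Hence a variety inside `JIDL1` is determined by its chains and by whether it contains `D₂`
(`IsVariety.subset_of_chains`). A chain with at most `n` elements lies in any variety having a chain
with at least `n` elements (`IsVariety.mem_of_card_le`). If chain sizes are unbounded, every chain
is a limit of its finite subalgebras and so belongs to the variety (`IsVariety.mem_of_unbounded`).
Each identity is thus checked only on chains and on `D₂`. -/

/-- A dual quasi-De Morgan operation on a Heyting algebra all of whose values are complemented and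
which satisfies the level one identity. -/
structure IsCentralQuasiDeMorgan {L : Type*} [HeytingAlgebra L] (p : L → L) : Prop where
  bot : p ⊥ = ⊤
  top : p ⊤ = ⊥
  inf : ∀ x y, p (x ⊓ y) = p x ⊔ p y
  sup2 : ∀ x y, p (p (x ⊔ y)) = p (p x) ⊔ p (p y)
  le : ∀ x, p (p x) ≤ x
  compl : ∀ x, p x ⊔ (p x)ᶜ = ⊤
  level : ∀ x, x ⊓ (p x)ᶜ ≤ (p (p x)ᶜ)ᶜ

/-! ### Arithmetic of `p`. -/

namespace IsCentralQuasiDeMorgan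

variable {L : Type*} [HeytingAlgebra L] {p : L → L} (h : IsCentralQuasiDeMorgan p)
include h

theorem anti {x y : L} (hxy : x ≤ y) : p y ≤ p x := by
  have := h.inf x y
  rw [inf_eq_left.2 hxy] at this
  rw [this]
  exact le_sup_right

theorem triple (x : L) : p (p (p x)) = p x :=
  le_antisymm (h.le _) (h.anti (h.le x))

theorem compl_compl (x : L) : (p x)ᶜᶜ = p x :=
  (IsCompl.of_eq (inf_compl_self _) (h.compl x)).symm.compl_eq

/-- Applying `p ∘ p` to `p x ⊔ (p x)ᶜ = ⊤` shows that `p x` and `p (p (p x)ᶜ)` still cover `⊤`. -/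
theorem double_compl (x : L) : p (p (p x)ᶜ) = (p x)ᶜ := by
  refine le_antisymm (h.le _) ?_
  have h1 := h.sup2 (p x) (p x)ᶜ
  rw [h.compl, h.top, h.bot, h.triple] at h1
  calc (p x)ᶜ = (p x)ᶜ ⊓ (p x ⊔ p (p (p x)ᶜ)) := by rw [← h1, inf_top_eq]
    _ = (p x)ᶜ ⊓ p (p (p x)ᶜ) := by rw [inf_sup_left, compl_inf_self, bot_sup_eq]
    _ ≤ _ := inf_le_right

/-- A meet of two values of `p` is the complement of a single value, so `double_compl` applies. -/
theorem double_inf (x y : L) : p (p (p x ⊓ p y)) = p x ⊓ p y := by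
  have h1 : (p x)ᶜ ⊔ (p y)ᶜ = p (p (p x)ᶜ ⊓ p (p y)ᶜ) := by
    rw [h.inf, h.double_compl, h.double_compl]
  have h2 : p x ⊓ p y = ((p x)ᶜ ⊔ (p y)ᶜ)ᶜ := by
    rw [compl_sup, h.compl_compl, h.compl_compl]
  rw [h2, h1, h.double_compl]

theorem sup (x y : L) : p (x ⊔ y) = p x ⊓ p y := by
  rw [← h.double_inf, h.inf, ← h.sup2, h.triple]

/-- The two De Morgan laws carry the complementary pair `p x`, `(p x)ᶜ` to a complementary pair. -/
theorem map_compl (x : L) : p (p x)ᶜ = (p (p x))ᶜ := by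
  have h1 : p (p x) ⊔ p (p x)ᶜ = ⊤ := by rw [← h.inf, inf_compl_self, h.bot]
  have h2 : p (p x) ⊓ p (p x)ᶜ = ⊥ := by rw [← h.sup, h.compl, h.top]
  exact (IsCompl.of_eq h2 h1).compl_eq.symm

/-- The working form of the level one identity; it is used only in `compl_mem`. -/
theorem inf_compl_le (x : L) : x ⊓ (p x)ᶜ ≤ p (p x) := by
  have := h.level x
  rwa [h.map_compl, h.compl_compl] at this

end IsCentralQuasiDeMorgan

/-! ### Prime filters and their twins. -/

/-- A prime filter, given by its membership predicate, that is compatible with `p ∘ p`. -/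
structure IsPrimeFilterFor {L : Type*} [HeytingAlgebra L] (p : L → L) (Q : L → Prop) : Prop where
  top : Q ⊤
  bot : ¬ Q ⊥
  inf : ∀ x y, Q (x ⊓ y) ↔ Q x ∧ Q y
  sup : ∀ x y, Q (x ⊔ y) ↔ Q x ∨ Q y
  double : ∀ x, Q (p (p x)) ↔ Q x

theorem exists_primeFilter {L : Type*} [DistribLattice L] [BoundedOrder L] {z : L} (hz : z ≠ ⊤) :
    ∃ Q : L → Prop, Q ⊤ ∧ ¬ Q ⊥ ∧ (∀ x y, Q (x ⊓ y) ↔ Q x ∧ Q y) ∧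
      (∀ x y, Q (x ⊔ y) ↔ Q x ∨ Q y) ∧ ¬ Q z := by
  have hd : Disjoint ((Order.PFilter.principal (⊤ : L) : Order.PFilter L) : Set L)
      (Order.Ideal.principal z : Order.Ideal L) := by
    rw [Set.disjoint_left]
    intro a ha hb
    rw [SetLike.mem_coe, Order.PFilter.mem_principal] at ha
    rw [SetLike.mem_coe, Order.Ideal.mem_principal] at hb
    exact hz (top_le_iff.1 (ha.trans hb))
  obtain ⟨J, hJ, hzJ, hJd⟩ := DistribLattice.prime_ideal_of_disjoint_filter_ideal hd
  refine ⟨fun x => x ∉ J, hJ.1.top_notMem, fun hb => hb J.bot_mem, fun x y => ?_, fun x y => ?_,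
    fun hz' => hz' (hzJ (Order.Ideal.mem_principal.2 le_rfl))⟩
  · constructor
    · intro hxy
      exact ⟨fun hx => hxy (J.lower inf_le_left hx), fun hy => hxy (J.lower inf_le_right hy)⟩
    · rintro ⟨hx, hy⟩ hxy
      exact (hJ.mem_or_mem hxy).elim hx hy
  · show x ⊔ y ∉ J ↔ _
    rw [← not_and_or, Order.Ideal.sup_mem_iff]

namespace IsPrimeFilterFor

variable {L : Type*} [HeytingAlgebra L] {p : L → L} {Q : L → Prop}

theorem mono (hQ : IsPrimeFilterFor p Q) {x y : L} (hxy : x ≤ y) (hx : Q x) : Q y := by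
  rw [← inf_eq_left.2 hxy, hQ.inf] at hx
  exact hx.2

theorem mp (hQ : IsPrimeFilterFor p Q) {x y : L} (hxy : Q (x ⇨ y)) (hx : Q x) : Q y :=
  hQ.mono himp_inf_le ((hQ.inf _ _).2 ⟨hxy, hx⟩)

theorem himp_trans (hQ : IsPrimeFilterFor p Q) {x y z : L} (hxy : Q (x ⇨ y)) (hyz : Q (y ⇨ z)) :
    Q (x ⇨ z) :=
  hQ.mono (himp_triangle x y z) ((hQ.inf _ _).2 ⟨hxy, hyz⟩)

theorem compl_iff (hQ : IsPrimeFilterFor p Q) (h : IsCentralQuasiDeMorgan p) (x : L) :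
    Q (p x)ᶜ ↔ ¬ Q (p x) := by
  constructor
  · intro h1 h2
    exact hQ.bot (by rw [← inf_compl_self (p x), hQ.inf]; exact ⟨h2, h1⟩)
  · intro h1
    have h2 := hQ.top
    rw [← h.compl x, hQ.sup] at h2
    exact h2.resolve_left h1

/-- Since `p (p z) ≤ z`, a prime filter can avoid `p (p z)`. Its preimage under the idempotent
lattice endomorphism `p ∘ p` is compatible and avoids `z`. -/
theorem exists_not (h : IsCentralQuasiDeMorgan p) {z : L} (hz : z ≠ ⊤) :
    ∃ Q, IsPrimeFilterFor p Q ∧ ¬ Q z := by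
  have hz' : p (p z) ≠ ⊤ := fun e => hz (top_le_iff.1 (e ▸ h.le z))
  obtain ⟨Q, ht, hb, hi, hs, hn⟩ := exists_primeFilter hz'
  refine ⟨fun x => Q (p (p x)), ⟨?_, ?_, ?_, ?_, ?_⟩, hn⟩
  · rwa [h.top, h.bot]
  · rwa [h.bot, h.top]
  · intro x y
    rw [h.inf, h.sup, hi]
  · intro x y
    rw [h.sup2, hs]
  · intro x
    rw [h.triple]

/-- The twin of a prime filter under the involution induced by `p`. -/
theorem twin (hQ : IsPrimeFilterFor p Q) (h : IsCentralQuasiDeMorgan p) :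
    IsPrimeFilterFor p fun x => ¬ Q (p x) where
  top := by rw [h.top]; exact hQ.bot
  bot := by rw [h.bot]; exact not_not.2 hQ.top
  inf x y := by rw [h.inf, hQ.sup, not_or]
  sup x y := by rw [h.sup, hQ.inf, not_and_or]
  double x := by rw [h.triple]

/-- Off the fixed points of the involution there are separating elements. -/
theorem exists_separating (hQ : IsPrimeFilterFor p Q) (h : IsCentralQuasiDeMorgan p)
    {b : L} (hb : Q b ↔ Q (p b)) : ∃ c, (Q c ∧ Q (p c)) ∧ ∃ d, ¬ Q d ∧ ¬ Q (p d) := by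
  by_cases h1 : Q b
  -- Complementing flips both memberships. Only values of `p` are known to be complemented, so `p b`
  -- is used rather than `b`.
  · refine ⟨b, ⟨h1, hb.1 h1⟩, (p b)ᶜ, ?_, ?_⟩
    · rw [hQ.compl_iff h]
      exact not_not.2 (hb.1 h1)
    · rw [h.map_compl, hQ.compl_iff h, hQ.double]
      exact not_not.2 h1
  · have h2 : ¬ Q (p b) := fun h3 => h1 (hb.2 h3)
    refine ⟨(p b)ᶜ, ⟨?_, ?_⟩, b, h1, h2⟩
    · rwa [hQ.compl_iff h]
    · rwa [h.map_compl, hQ.compl_iff h, hQ.double]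

/-- Off the fixed points `Q` is maximal. Joining `x` with `d` gives `y` with `y`, `p y` and `p (p
y)` all outside `Q`; by level one, `x` is disjoint from `(p y)ᶜ ⊓ (p (p y))ᶜ`, which lies in `Q`. -/
theorem compl_mem (hQ : IsPrimeFilterFor p Q) (h : IsCentralQuasiDeMorgan p)
    {d : L} (hd : ¬ Q d) (hd' : ¬ Q (p d)) {x : L} (hx : ¬ Q x) : Q xᶜ := by
  have hy : ¬ Q (x ⊔ d) := by rw [hQ.sup]; tauto
  have hpy : ¬ Q (p (x ⊔ d)) := by rw [h.sup, hQ.inf]; tauto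
  have hppy : ¬ Q (p (p (x ⊔ d))) := by rwa [hQ.double]
  have hle : (p (x ⊔ d))ᶜ ⊓ (p (p (x ⊔ d)))ᶜ ≤ xᶜ := by
    rw [le_compl_iff_disjoint_right, disjoint_iff_inf_le]
    calc _ ≤ ((x ⊔ d) ⊓ (p (x ⊔ d))ᶜ) ⊓ (p (p (x ⊔ d)))ᶜ :=
          le_inf (le_inf (inf_le_right.trans le_sup_left) (inf_le_left.trans inf_le_left))
            (inf_le_left.trans inf_le_right)
      _ ≤ p (p (x ⊔ d)) ⊓ (p (p (x ⊔ d)))ᶜ := inf_le_inf_right _ (h.inf_compl_le _)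
      _ = ⊥ := inf_compl_self _
  refine hQ.mono hle ?_
  rw [hQ.inf, hQ.compl_iff h, hQ.compl_iff h]
  exact ⟨hpy, hppy⟩

theorem himp_iff (hQ : IsPrimeFilterFor p Q) (h : IsCentralQuasiDeMorgan p)
    {d : L} (hd : ¬ Q d) (hd' : ¬ Q (p d)) (x y : L) : Q (x ⇨ y) ↔ (Q x → Q y) := by
  refine ⟨hQ.mp, fun hxy => ?_⟩
  by_cases hx : Q x
  · exact hQ.mono le_himp (hxy hx)
  · exact hQ.mono compl_le_himp (hQ.compl_mem h hd hd' hx)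

/-- At a fixed point this makes equivalence modulo `Q` compatible with `p`: a value of `p` or its
complement lies in `Q`. -/
theorem himp_map (hQ : IsPrimeFilterFor p Q) (h : IsCentralQuasiDeMorgan p)
    (hf : ∀ w, Q w ↔ ¬ Q (p w)) {x y : L} (hxy : Q (x ⇨ y)) : Q (p y ⇨ p x) := by
  by_cases hx : Q (p x)
  · exact hQ.mono le_himp hx
  · refine hQ.mono compl_le_himp ((hQ.compl_iff h _).2 ?_)
    exact (hf y).1 (hQ.mp hxy ((hf x).2 hx))

end IsPrimeFilterFor

namespace DQDAlg

/-! ### From the identities of `JIDL1` to Heyting algebras. -/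

section Heyting

variable {L : Type u} [DQDAlgebra L]

/-- Below `y ⇨ a` both `a` and `y` restrict to `a`, so there `a ⇨ y` agrees with `a ⇨ a`. The linear
identity for a comparable pair then reduces to `a ⇨ y = ⊤`, which is why linear algebras are
Heyting. -/
theorem himp_le_himp_of_le {a y : L} (hay : a ≤ y) : y ⇨ a ≤ a ⇨ y := by
  have h1 : a ⊓ (y ⇨ a) = a := by
    rw [DQDAlgebra.inf_imp_eq, inf_eq_left.2 hay, inf_idem, DQDAlgebra.imp_self_eq, inf_top_eq]
  have h2 : y ⊓ (y ⇨ a) = a := by rw [DQDAlgebra.inf_imp, inf_eq_right.2 hay]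
  have h3 : (y ⇨ a) ⊓ (a ⇨ y) = y ⇨ a := by
    rw [DQDAlgebra.inf_imp_eq, inf_comm _ a, h1, inf_comm _ y, h2, DQDAlgebra.imp_self_eq,
      inf_top_eq]
  exact inf_eq_left.1 h3

/-- The Heyting algebra reduct. -/
abbrev heytingReduct (h : ∀ x y : L, (x ⊓ y) ⇨ y = ⊤) : HeytingAlgebra L :=
  { (inferInstance : Lattice L), (inferInstance : BoundedOrder L), (inferInstance : HImp L) with
    compl := pcompl
    himp_bot := fun _ => rfl
    le_himp_iff := by
      intro a b c
      constructor
      · intro hab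
        calc a ⊓ b ≤ (b ⇨ c) ⊓ b := inf_le_inf_right _ hab
          _ = b ⊓ c := by rw [inf_comm, DQDAlgebra.inf_imp]
          _ ≤ c := inf_le_right
      · intro hab
        have h1 : a ⊓ b ≤ a ⊓ c := le_inf inf_le_left hab
        have h2 : (a ⊓ b) ⇨ (a ⊓ c) = ⊤ := by
          have := h (a ⊓ b) (a ⊓ c)
          rwa [inf_eq_left.2 h1] at this
        have h3 : a ⊓ (b ⇨ c) = a := by rw [DQDAlgebra.inf_imp_eq, h2, inf_top_eq]
        exact inf_eq_left.1 h3 }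

end Heyting

theorem IsLinear.isHeyting {A : DQDAlg.{u}} (h : IsLinear A) : IsHeyting A := by
  intro x y
  have h1 := h (x ⊓ y) y
  rwa [sup_eq_left.2 (himp_le_himp_of_le inf_le_right)] at h1

theorem isCentral_of_mem_JIDL1 {A : DQDAlg.{u}} (hA : A ∈ JIDL1) :
    letI := heytingReduct hA.2.1.isHeyting
    IsCentralQuasiDeMorgan (prime : A → A) := by
  let := heytingReduct hA.2.1.isHeyting
  refine ⟨DQDAlgebra.prime_bot, DQDAlgebra.prime_top, DQDAlgebra.prime_inf,
    DQDAlgebra.prime_prime_sup, DQDAlgebra.prime_prime_le, fun x => ?_, fun x => ?_⟩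
  -- JI-distributivity at `y = x′`, `z = 0` reads `x′ ∨ x′* = x′ → x′`.
  · have := hA.1 x (prime x) ⊥
    rw [sup_idem, sup_bot_eq, himp_self] at this
    exact this
  · have h1 : x ⊓ pcompl (prime x) =
        (x ⊓ pcompl (prime x)) ⊓ pcompl (prime (pcompl (prime x))) := hA.2.2 x
    exact inf_eq_left.1 h1.symm

/-! ### Chains -/

/-- Heyting chains with the dual pseudocomplement. -/
structure IsDPChain (A : DQDAlg.{u}) : Prop where
  heyting : IsHeyting A
  chain : IsChainAlg A
  prime_eq : ∀ x : A, x ≠ ⊤ → prime x = ⊤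

/-! ### Homomorphisms -/

theorem IsHom.comp {A : DQDAlg.{u}} {B : DQDAlg.{v}} {C : DQDAlg.{w}} {g : B → C} {f : A → B}
    (hg : IsHom g) (hf : IsHom f) : IsHom (g ∘ f) := by
  constructor <;> intros <;>
    simp [hf.map_sup, hf.map_inf, hf.map_imp, hf.map_prime, hf.map_bot, hf.map_top,
      hg.map_sup, hg.map_inf, hg.map_imp, hg.map_prime, hg.map_bot, hg.map_top]

theorem isHom_eval {ι : Type w} (A : ι → DQDAlg.{u}) (i : ι) :
    IsHom (fun x : pi A => (x : ∀ i, A i) i) :=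
  ⟨fun _ _ => rfl, fun _ _ => rfl, fun _ _ => rfl, fun _ => rfl, rfl, rfl⟩

theorem isHom_pi {ι : Type w} {B : DQDAlg.{v}} {A : ι → DQDAlg.{u}} {f : ∀ i, B → A i}
    (hf : ∀ i, IsHom (f i)) : IsHom (A := B) (B := pi A) (fun x i => f i x) :=
  ⟨fun x y => funext fun i => (hf i).map_sup x y, fun x y => funext fun i => (hf i).map_inf x y,
    fun x y => funext fun i => (hf i).map_imp x y, fun x => funext fun i => (hf i).map_prime x,
    funext fun i => (hf i).map_bot, funext fun i => (hf i).map_top⟩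

theorem IsHom.map_pcompl {A : DQDAlg.{u}} {B : DQDAlg.{v}} {f : A → B} (hf : IsHom f) (x : A) :
    f (pcompl x) = pcompl (f x) := by
  simp [pcompl, hf.map_imp, hf.map_bot]

theorem IsHom.map_finsetSup {A : DQDAlg.{u}} {B : DQDAlg.{v}} {f : A → B} (hf : IsHom f)
    {ι : Type*} (s : Finset ι) (x : ι → A) : f (s.sup x) = s.sup fun i => f (x i) :=
  Finset.apply_sup_eq_sup_comp f hf.map_sup hf.map_bot

/-- A copy of `B` in a possibly larger universe. -/
def lift (B : DQDAlg.{v}) : DQDAlg.{max v u} := pi fun _ : PUnit.{u + 1} => B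

theorem iso_lift (B : DQDAlg.{v}) : Iso (lift.{u} B) B :=
  ⟨fun x : pi _ => x PUnit.unit, isHom_eval _ _,
    fun _ _ h => funext fun _ => h, fun y => ⟨fun _ => y, rfl⟩⟩

/-! ### Varieties -/

/-- A family of operations, one on each algebra, that commutes with homomorphisms. -/
def IsNatural (T : ∀ A : DQDAlg.{u}, (ℕ → A) → A) : Prop :=
  ∀ (A B : DQDAlg.{u}) (f : A → B), IsHom f → ∀ x, f (T A x) = T B (f ∘ x)

/-- The easy half of Birkhoff's theorem, with natural operations in the role of terms. -/
theorem isVariety_eq {T S : ∀ A : DQDAlg.{u}, (ℕ → A) → A} (hT : IsNatural T)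
    (hS : IsNatural S) : IsVariety {A : DQDAlg.{u} | ∀ x, T A x = S A x} where
  image A B hA f hf hs y := by
    obtain ⟨x, rfl⟩ : ∃ x : ℕ → A, f ∘ x = y :=
      ⟨fun n => (hs (y n)).choose, funext fun n => (hs (y n)).choose_spec⟩
    rw [← hT A B f hf, ← hS A B f hf, hA x]
  sub A B hA f hf hi x := hi (by rw [hT B A f hf, hS B A f hf, hA])
  prod ι A hA x := funext fun i => by
    have h1 := hT _ _ _ (isHom_eval A i) x
    have h2 := hS _ _ _ (isHom_eval A i) x
    exact h1.trans ((hA i _).trans h2.symm)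

theorem IsVariety.inter {V W : Set DQDAlg.{u}} (hV : IsVariety V) (hW : IsVariety W) :
    IsVariety (V ∩ W) where
  image A B hA f hf hs := ⟨hV.image A B hA.1 f hf hs, hW.image A B hA.2 f hf hs⟩
  sub A B hA f hf hs := ⟨hV.sub A B hA.1 f hf hs, hW.sub A B hA.2 f hf hs⟩
  prod ι A hA := ⟨hV.prod ι A fun i => (hA i).1, hW.prod ι A fun i => (hA i).2⟩

theorem isVariety_of_iff {P : DQDAlg.{u} → Prop} (T S : ∀ A : DQDAlg.{u}, (ℕ → A) → A)
    (hT : IsNatural T) (hS : IsNatural S) (h : ∀ A, P A ↔ ∀ x, T A x = S A x) :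
    IsVariety {A | P A} := by
  simp only [h]
  exact isVariety_eq hT hS

theorem forall_seq_iff {α : Type u} {P : α → α → α → Prop} :
    (∀ x y z, P x y z) ↔ ∀ x : ℕ → α, P (x 0) (x 1) (x 2) :=
  ⟨fun h _ => h _ _ _, fun h x y z => h fun n => if n = 0 then x else if n = 1 then y else z⟩

theorem forall_seq_iff_two {α : Type u} {P : α → α → Prop} :
    (∀ x y, P x y) ↔ ∀ x : ℕ → α, P (x 0) (x 1) :=
  ⟨fun h _ => h _ _, fun h x y => h fun n => if n = 0 then x else y⟩

theorem forall_seq_iff_one {α : Type u} {P : α → Prop} :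
    (∀ x, P x) ↔ ∀ x : ℕ → α, P (x 0) :=
  ⟨fun h _ => h _, fun h x => h fun _ => x⟩


theorem isVariety_JIDL1 : IsVariety JIDL1.{u} := by
  have h1 : IsVariety {A : DQDAlg.{u} | IsJID A} :=
    isVariety_of_iff (fun A x => prime (x 0) ⊔ (x 1 ⇨ x 2))
      (fun A x => (prime (x 0) ⊔ x 1) ⇨ (prime (x 0) ⊔ x 2))
      (fun A B f hf x => by simp [hf.map_sup, hf.map_imp, hf.map_prime])
      (fun A B f hf x => by simp [hf.map_sup, hf.map_imp, hf.map_prime])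
      (fun A => forall_seq_iff)
  have h2 : IsVariety {A : DQDAlg.{u} | IsLinear A} :=
    isVariety_of_iff (fun A x => (x 0 ⇨ x 1) ⊔ (x 1 ⇨ x 0)) (fun A x => ⊤)
      (fun A B f hf x => by simp [hf.map_sup, hf.map_imp])
      (fun A B f hf x => hf.map_top) (fun A => forall_seq_iff_two)
  have h3 : IsVariety {A : DQDAlg.{u} | HasLevel A 1} :=
    isVariety_of_iff (fun A x => levelTerm 1 (x 0)) (fun A x => levelTerm 2 (x 0))
      (fun A B f hf x => by
        simp [levelTerm, iterPrimeStar, hf.map_inf, hf.map_prime, hf.map_pcompl])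
      (fun A B f hf x => by
        simp [levelTerm, iterPrimeStar, hf.map_inf, hf.map_prime, hf.map_pcompl])
      (fun A => forall_seq_iff_one)
  exact h1.inter (h2.inter h3)

theorem isVariety_sup_prime : IsVariety {A : DQDAlg.{u} | ∀ x : A, x ⊔ prime x = ⊤} :=
  isVariety_of_iff (fun A x => x 0 ⊔ prime (x 0)) (fun A x => ⊤)
    (fun A B f hf x => by simp [hf.map_sup, hf.map_prime])
    (fun A B f hf x => hf.map_top) (fun A => forall_seq_iff_one)

theorem isVariety_prime_prime : IsVariety {A : DQDAlg.{u} | ∀ x : A, prime (prime x) = x} :=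
  isVariety_of_iff (fun A x => prime (prime (x 0))) (fun A x => x 0)
    (fun A B f hf x => by simp [hf.map_prime])
    (fun A B f hf x => rfl) (fun A => forall_seq_iff_one)

theorem isVariety_satisfiesC (n : ℕ) : IsVariety {A : DQDAlg.{u} | SatisfiesC n A} :=
  isVariety_of_iff
    (fun A x => (Finset.Icc 1 n).sup x ⊔ (Finset.Ico 1 n).sup (fun i => x i ⇨ x (i + 1)))
    (fun A x => ⊤)
    (fun A B f hf x => by
      simp only [hf.map_sup, hf.map_finsetSup, hf.map_imp]
      rfl)
    (fun A B f hf x => hf.map_top) (fun A => Iff.rfl)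

theorem isVariety_regular :
    IsVariety {A : DQDAlg.{u} | ∀ x y : A, x ⊓ plus x ≤ y ⊔ pcompl y} :=
  isVariety_of_iff (fun A x => (x 0 ⊓ plus (x 0)) ⊓ (x 1 ⊔ pcompl (x 1)))
    (fun A x => x 0 ⊓ plus (x 0))
    (fun A B f hf x => by
      simp [plus, hf.map_sup, hf.map_inf, hf.map_prime, hf.map_pcompl])
    (fun A B f hf x => by simp [plus, hf.map_inf, hf.map_prime, hf.map_pcompl])
    (fun A => by simp only [inf_eq_left]; exact forall_seq_iff_two)

theorem isVariety_inf_prime_le :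
    IsVariety {A : DQDAlg.{u} | ∀ x y : A, x ⊓ prime x ≤ y ⊔ pcompl y} :=
  isVariety_of_iff (fun A x => (x 0 ⊓ prime (x 0)) ⊓ (x 1 ⊔ pcompl (x 1)))
    (fun A x => x 0 ⊓ prime (x 0))
    (fun A B f hf x => by simp [hf.map_sup, hf.map_inf, hf.map_prime, hf.map_pcompl])
    (fun A B f hf x => by simp [hf.map_inf, hf.map_prime])
    (fun A => by simp only [inf_eq_left]; exact forall_seq_iff_two)

theorem isVariety_prime_eq_plus : IsVariety {A : DQDAlg.{u} | ∀ x : A, prime x = plus x} :=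
  isVariety_of_iff (fun A x => prime (x 0)) (fun A x => plus (x 0))
    (fun A B f hf x => by simp [hf.map_prime])
    (fun A B f hf x => by simp [plus, hf.map_prime, hf.map_pcompl])
    (fun A => forall_seq_iff_one)

theorem generated_subset {K V : Set DQDAlg.{u}} (hV : IsVariety V) (h : K ⊆ V) :
    generated K ⊆ V :=
  Set.sInter_subset_of_mem ⟨hV, h⟩

theorem IsVariety.mem_of_iso {V : Set DQDAlg.{u}} (hV : IsVariety V) {A B : DQDAlg.{u}}
    (h : Iso A B) (hB : B ∈ V) : A ∈ V := by
  obtain ⟨f, hf, hb⟩ := h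
  exact hV.sub B A hB f hf hb.1

theorem lift_mem_generatedBy (B : DQDAlg.{0}) : lift.{u} B ∈ generatedBy.{u} B :=
  subset_generated _ (iso_lift.{u} B)

theorem iso_of_iso_lift {A : DQDAlg.{u}} {B : DQDAlg.{0}} (h : Iso A B) :
    ∃ f : A → lift.{u} B, IsHom f ∧ Function.Bijective f := by
  obtain ⟨f, hf, hb⟩ := h
  refine ⟨fun x _ => f x, isHom_pi fun _ => hf, fun x y hxy => hb.1 (congrFun hxy PUnit.unit),
    fun y => ?_⟩
  obtain ⟨x, hx⟩ := hb.2 (y PUnit.unit)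
  exact ⟨x, funext fun _ => hx⟩

theorem generatedBy_subset_iff {V : Set DQDAlg.{u}} (hV : IsVariety V) (B : DQDAlg.{0}) :
    generatedBy.{u} B ⊆ V ↔ lift.{u} B ∈ V :=
  ⟨fun h => h (lift_mem_generatedBy B), fun h => generated_subset hV fun _ hA =>
    hV.mem_of_iso (iso_of_iso_lift hA) h⟩

theorem IsVariety.mem_of_subsingleton {V : Set DQDAlg.{u}} (hV : IsVariety V) {A : DQDAlg.{u}}
    (hA : ∀ x y : A, x = y) : A ∈ V := by
  -- The empty product is the one-element algebra.
  have h0 : pi (fun i : PEmpty.{u + 1} => (i.elim : DQDAlg.{u})) ∈ V :=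
    hV.prod PEmpty _ fun i => i.elim
  refine hV.sub _ _ h0 (fun _ i => i.elim) ?_ fun x y _ => hA x y
  constructor <;> intros <;> exact funext fun i => i.elim

/-! ### Quotients -/

/-- Congruences. -/
structure IsCongruence (A : DQDAlg.{u}) (r : Setoid A) : Prop where
  sup : ∀ {a b c d : A}, r a b → r c d → r (a ⊔ c) (b ⊔ d)
  inf : ∀ {a b c d : A}, r a b → r c d → r (a ⊓ c) (b ⊓ d)
  imp : ∀ {a b c d : A}, r a b → r c d → r (a ⇨ c) (b ⇨ d)
  prime : ∀ {a b : A}, r a b → r (prime a) (prime b)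

namespace IsCongruence

variable {A : DQDAlg.{u}} {r : Setoid A} (h : IsCongruence A r)

/-- The lattice structure of a quotient. -/
abbrev lattice : Lattice (Quotient r) :=
  @Lattice.mk' (Quotient r) ⟨Quotient.map₂ (· ⊔ ·) fun _ _ h1 _ _ h2 => h.sup h1 h2⟩
    ⟨Quotient.map₂ (· ⊓ ·) fun _ _ h1 _ _ h2 => h.inf h1 h2⟩
    (by rintro ⟨a⟩ ⟨b⟩; exact congrArg (Quotient.mk r) (sup_comm a b))
    (by rintro ⟨a⟩ ⟨b⟩ ⟨c⟩; exact congrArg (Quotient.mk r) (sup_assoc a b c))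
    (by rintro ⟨a⟩ ⟨b⟩; exact congrArg (Quotient.mk r) (inf_comm a b))
    (by rintro ⟨a⟩ ⟨b⟩ ⟨c⟩; exact congrArg (Quotient.mk r) (inf_assoc a b c))
    (by rintro ⟨a⟩ ⟨b⟩; exact congrArg (Quotient.mk r) sup_inf_self)
    (by rintro ⟨a⟩ ⟨b⟩; exact congrArg (Quotient.mk r) inf_sup_self)

/-- The quotient algebra. -/
def quotient : DQDAlg.{u} where
  carrier := Quotient r
  str :=
    { h.lattice with
      top := Quotient.mk r ⊤
      bot := Quotient.mk r ⊥
      le_top := by rintro ⟨a⟩; exact congrArg (Quotient.mk r) (sup_top_eq a)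
      bot_le := by rintro ⟨a⟩; exact congrArg (Quotient.mk r) (bot_sup_eq a)
      himp := Quotient.map₂ (· ⇨ ·) fun _ _ h1 _ _ h2 => h.imp h1 h2
      prime := Quotient.map DQDAlg.prime fun _ _ h1 => h.prime h1
      inf_imp := by
        rintro ⟨a⟩ ⟨b⟩; exact congrArg (Quotient.mk r) (DQDAlgebra.inf_imp a b)
      inf_imp_eq := by
        rintro ⟨a⟩ ⟨b⟩ ⟨c⟩; exact congrArg (Quotient.mk r) (DQDAlgebra.inf_imp_eq a b c)
      imp_self_eq := by
        rintro ⟨a⟩; exact congrArg (Quotient.mk r) (DQDAlgebra.imp_self_eq a)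
      prime_bot := congrArg (Quotient.mk r) DQDAlgebra.prime_bot
      prime_top := congrArg (Quotient.mk r) DQDAlgebra.prime_top
      prime_inf := by
        rintro ⟨a⟩ ⟨b⟩; exact congrArg (Quotient.mk r) (DQDAlgebra.prime_inf a b)
      prime_prime_sup := by
        rintro ⟨a⟩ ⟨b⟩; exact congrArg (Quotient.mk r) (DQDAlgebra.prime_prime_sup a b)
      prime_prime_le := by
        rintro ⟨a⟩; exact congrArg (Quotient.mk r) (sup_eq_right.2 (DQDAlgebra.prime_prime_le a)) }

/-- The canonical projection. -/
def proj (a : A) : h.quotient := Quotient.mk r a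

theorem isHom_proj : IsHom h.proj :=
  ⟨fun _ _ => rfl, fun _ _ => rfl, fun _ _ => rfl, fun _ => rfl, rfl, rfl⟩

theorem proj_surjective : Function.Surjective h.proj := Quotient.mk_surjective

theorem proj_eq_iff {a b : A} : h.proj a = h.proj b ↔ r a b := Quotient.eq

end IsCongruence

/-! ### The subdirect representation -/

/-- An algebra in `JIDL₁` is residually a Heyting chain with dual pseudocomplement or `D₂`. -/
theorem exists_separating_hom {A : DQDAlg.{u}} (hA : A ∈ JIDL1) {x y : A} (hxy : x ≠ y) :
    ∃ (B : DQDAlg.{u}) (f : A → B), IsHom f ∧ Function.Surjective f ∧ f x ≠ f y ∧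
      (IsDPChain B ∨ B = lift.{u} algD2) := by
  have hlin := hA.2.1
  have hH : IsHeyting A := hlin.isHeyting
  have hc := isCentral_of_mem_JIDL1 hA
  let := heytingReduct hH
  obtain ⟨Q, hQ, hz⟩ : ∃ Q, IsPrimeFilterFor (prime : A → A) Q ∧ ¬ (Q (x ⇨ y) ∧ Q (y ⇨ x)) := by
    by_cases h1 : x ⇨ y = ⊤
    · by_cases h2 : y ⇨ x = ⊤
      · exact absurd (le_antisymm (himp_eq_top_iff.1 h1) (himp_eq_top_iff.1 h2)) hxy
      · obtain ⟨Q, hQ, hn⟩ := IsPrimeFilterFor.exists_not hc h2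
        exact ⟨Q, hQ, fun h => hn h.2⟩
    · obtain ⟨Q, hQ, hn⟩ := IsPrimeFilterFor.exists_not hc h1
      exact ⟨Q, hQ, fun h => hn h.1⟩
  -- The split is on whether `Q` equals its twin.
  by_cases hf : ∀ w, Q w ↔ ¬ Q (prime w)
  · let r : Setoid A := ⟨fun a b => Q (a ⇨ b) ∧ Q (b ⇨ a), fun a => by simp [hQ.top],
      fun h => ⟨h.2, h.1⟩,
      fun h1 h2 => ⟨hQ.himp_trans h1.1 h2.1, hQ.himp_trans h2.2 h1.2⟩⟩
    have hsup : ∀ {a b c d : A}, Q (a ⇨ b) → Q (c ⇨ d) → Q ((a ⊔ c) ⇨ (b ⊔ d)) := by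
      intro a b c d h1 h2
      refine hQ.mono ?_ ((hQ.inf _ _).2 ⟨h1, h2⟩)
      rw [sup_himp_distrib]
      exact inf_le_inf (himp_le_himp_left le_sup_left) (himp_le_himp_left le_sup_right)
    have hinf : ∀ {a b c d : A}, Q (a ⇨ b) → Q (c ⇨ d) → Q ((a ⊓ c) ⇨ (b ⊓ d)) := by
      intro a b c d h1 h2
      refine hQ.mono ?_ ((hQ.inf _ _).2 ⟨h1, h2⟩)
      rw [himp_inf_distrib]
      exact inf_le_inf (himp_le_himp_right inf_le_left) (himp_le_himp_right inf_le_right)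
    have himp : ∀ {a b c d : A}, Q (b ⇨ a) → Q (c ⇨ d) → Q ((a ⇨ c) ⇨ (b ⇨ d)) := by
      intro a b c d h1 h2
      refine hQ.mono ?_ ((hQ.inf _ _).2 ⟨h1, h2⟩)
      rw [le_himp_iff]
      calc (b ⇨ a) ⊓ (c ⇨ d) ⊓ (a ⇨ c) ≤ ((b ⇨ a) ⊓ (a ⇨ c)) ⊓ (c ⇨ d) :=
            le_inf (le_inf (inf_le_left.trans inf_le_left) inf_le_right)
              (inf_le_left.trans inf_le_right)
        _ ≤ (b ⇨ c) ⊓ (c ⇨ d) := inf_le_inf_right _ (himp_triangle b a c)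
        _ ≤ b ⇨ d := himp_triangle b c d
    have hr : IsCongruence A r :=
      ⟨fun h1 h2 => ⟨hsup h1.1 h2.1, hsup h1.2 h2.2⟩, fun h1 h2 => ⟨hinf h1.1 h2.1, hinf h1.2 h2.2⟩,
        fun h1 h2 => ⟨himp h1.2 h2.1, himp h1.1 h2.2⟩,
        fun h1 => ⟨hQ.himp_map hc hf h1.2, hQ.himp_map hc hf h1.1⟩⟩
    have hp := hr.isHom_proj
    have hle : ∀ a b : A, Q (a ⇨ b) → hr.proj a ≤ hr.proj b := by
      intro a b hab
      rw [← sup_eq_right, ← hp.map_sup, hr.proj_eq_iff]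
      refine ⟨?_, ?_⟩
      · rw [sup_himp_distrib, himp_self, inf_top_eq]
        exact hab
      · rw [himp_eq_top_iff.2 le_sup_right]
        exact hQ.top
    refine ⟨hr.quotient, hr.proj, hp, hr.proj_surjective, ?_, Or.inl ⟨?_, ?_, ?_⟩⟩
    · rw [Ne, hr.proj_eq_iff]
      exact hz
    · intro a b
      obtain ⟨a, rfl⟩ := hr.proj_surjective a
      obtain ⟨b, rfl⟩ := hr.proj_surjective b
      rw [← hp.map_inf, ← hp.map_imp, hH, hp.map_top]
    · intro a b
      obtain ⟨a, rfl⟩ := hr.proj_surjective a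
      obtain ⟨b, rfl⟩ := hr.proj_surjective b
      have h1 := hQ.top
      rw [← hlin a b] at h1
      exact ((hQ.sup _ _).1 h1).imp (hle a b) (hle b a)
    · intro a ha
      obtain ⟨a, rfl⟩ := hr.proj_surjective a
      have h1 : ¬ Q a := fun h1 => ha (top_le_iff.1 (by
        rw [← hp.map_top]
        refine hle _ _ ?_
        rwa [top_himp]))
      have h2 : Q (prime a) := not_not.1 fun h2 => h1 ((hf a).2 h2)
      rw [← hp.map_prime, ← top_le_iff, ← hp.map_top]
      refine hle _ _ ?_
      rwa [top_himp]
  · obtain ⟨b, hb⟩ : ∃ b, Q b ↔ Q (prime b) := by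
      by_contra! hb
      exact hf fun w => by have := hb w; tauto
    obtain ⟨c, ⟨hc1, hc2⟩, d, hd1, hd2⟩ := hQ.exists_separating hc hb
    classical
    -- The coordinates are membership in `Q` and in its twin; `′` swaps them up to negation, as it
    -- does in `D₂`.
    let g : A → algD2 := fun w => (decide (Q w), decide (¬ Q (prime w)))
    have hT := hQ.twin hc
    have himp := hQ.himp_iff hc hd1 hd2
    -- For the twin `c` takes over the role of `d`: both `c` and `c′` lie outside it.
    have himp' := hT.himp_iff hc (d := c) (not_not.2 hc2) (not_not.2 ((hQ.double c).2 hc1))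
    have hg : IsHom g := by
      constructor
      · intro a b
        refine Prod.ext ?_ ?_
        · show decide _ = (decide _ || decide _)
          simp only [hQ.sup, Bool.decide_or]
        · show decide _ = (decide _ || decide _)
          simp only [hT.sup, Bool.decide_or]
      · intro a b
        refine Prod.ext ?_ ?_
        · show decide _ = (decide _ && decide _)
          simp only [hQ.inf, Bool.decide_and]
        · show decide _ = (decide _ && decide _)
          simp only [hT.inf, Bool.decide_and]
      · intro a b
        refine Prod.ext ?_ ?_
        · show decide (Q (a ⇨ b)) = (!decide (Q a) || decide (Q b))
          rw [Bool.eq_iff_iff]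
          simp [himp, imp_iff_not_or]
        · show decide (¬ Q (prime (a ⇨ b))) = (!decide (¬ Q (prime a)) || decide (¬ Q (prime b)))
          rw [Bool.eq_iff_iff, decide_eq_true_iff, himp']
          simp only [imp_iff_not_or, Bool.or_eq_true, Bool.not_eq_true', decide_eq_true_iff,
            decide_eq_false_iff_not]
      · intro a
        refine Prod.ext ?_ ?_
        · show decide (Q (prime a)) = !decide (¬ Q (prime a))
          simp
        · show decide (¬ Q (prime (prime a))) = !decide (Q a)
          simp [hQ.double]
      · refine Prod.ext ?_ ?_
        · exact decide_eq_false hQ.bot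
        · exact decide_eq_false hT.bot
      · refine Prod.ext ?_ ?_
        · exact decide_eq_true hQ.top
        · exact decide_eq_true hT.top
    refine ⟨lift.{u} algD2, fun w _ => g w, isHom_pi fun _ => hg, ?_, ?_, Or.inr rfl⟩
    · have hgs : Function.Surjective g := by
        rintro ⟨_ | _, _ | _⟩
        · exact ⟨⊥, hg.map_bot⟩
        · exact ⟨d, by simp [g, hd1, hd2]; rfl⟩
        · exact ⟨c, by simp [g, hc1, hc2]; rfl⟩
        · exact ⟨⊤, hg.map_top⟩
      intro w
      obtain ⟨a, ha⟩ := hgs (w PUnit.unit)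
      exact ⟨a, funext fun _ => ha⟩
    · intro he
      have h1 : g x = g y := congrFun he PUnit.unit
      have h2 : Q x ↔ Q y := decide_eq_decide.1 (congrArg Prod.fst h1)
      exact hz ⟨(himp x y).2 h2.1, (himp y x).2 h2.2⟩

/-- Varieties of members of `JIDL₁` are compared on chains and on `D₂`. -/
theorem IsVariety.subset_of_chains {V W : Set DQDAlg.{u}} (hV : IsVariety V) (hVJ : V ⊆ JIDL1)
    (hW : IsVariety W) (hch : ∀ C ∈ V, IsDPChain C → C ∈ W)
    (hD : lift.{u} algD2 ∈ V → lift.{u} algD2 ∈ W) : V ⊆ W := by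
  intro A hA
  -- One separating quotient for each pair of distinct elements; their product contains `A`.
  have key : ∀ i : {q : A × A // q.1 ≠ q.2}, ∃ (B : DQDAlg.{u}) (f : A → B),
      B ∈ W ∧ IsHom f ∧ f i.1.1 ≠ f i.1.2 := by
    intro i
    obtain ⟨B, f, hf, hs, hne, hB⟩ := exists_separating_hom (hVJ hA) i.2
    have hBV : B ∈ V := hV.image A B hA f hf hs
    refine ⟨B, f, ?_, hf, hne⟩
    rcases hB with hB | rfl
    · exact hch B hBV hB
    · exact hD hBV
  choose B f hBW hf hne using key
  refine hW.sub _ A (hW.prod _ B hBW) _ (isHom_pi hf) fun x y hxy => ?_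
  by_contra h
  exact hne ⟨(x, y), h⟩ (congrFun hxy ⟨(x, y), h⟩)

/-! ### Operations on chains. -/

theorem pcompl_top {L : Type u} [DQDAlgebra L] : pcompl (⊤ : L) = ⊥ := by
  have := DQDAlgebra.inf_imp (⊤ : L) ⊥
  rwa [top_inf_eq, top_inf_eq] at this

theorem pcompl_bot {L : Type u} [DQDAlgebra L] : pcompl (⊥ : L) = ⊤ :=
  DQDAlgebra.imp_self_eq _

theorem prime_top {L : Type u} [DQDAlgebra L] : prime (⊤ : L) = ⊥ := DQDAlgebra.prime_top

theorem prime_bot {L : Type u} [DQDAlgebra L] : prime (⊥ : L) = ⊤ := DQDAlgebra.prime_bot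

theorem IsHeyting.himp_of_le {A : DQDAlg.{u}} (h : IsHeyting A) {x y : A} (hxy : x ≤ y) :
    x ⇨ y = ⊤ := by
  have := h x y
  rwa [inf_eq_left.2 hxy] at this

namespace IsDPChain

variable {C : DQDAlg.{u}} (h : IsDPChain C)
include h

theorem himp_of_not_le {x y : C} (hxy : ¬ x ≤ y) : x ⇨ y = y := by
  have hyx : y ≤ x := (h.chain x y).resolve_left hxy
  have h1 : x ⊓ (x ⇨ y) = y := by rw [DQDAlgebra.inf_imp, inf_eq_right.2 hyx]
  rcases h.chain x (x ⇨ y) with h2 | h2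
  · rw [inf_eq_left.2 h2] at h1
    exact absurd h1.le hxy
  · rwa [inf_eq_right.2 h2] at h1

theorem prime_eq_or (x : C) : prime x = ⊤ ∨ prime x = ⊥ := by
  by_cases hx : x = ⊤
  · right; rw [hx, prime_top]
  · exact Or.inl (h.prime_eq x hx)

theorem sup_ne_top {x y : C} (hx : x ≠ ⊤) (hy : y ≠ ⊤) : x ⊔ y ≠ ⊤ := by
  rcases h.chain x y with hxy | hxy
  · rwa [sup_eq_right.2 hxy]
  · rwa [sup_eq_left.2 hxy]

theorem sup_prime (x : C) : x ⊔ prime x = ⊤ := by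
  by_cases hx : x = ⊤
  · rw [hx, top_sup_eq]
  · rw [h.prime_eq x hx, sup_top_eq]

theorem prime_eq_plus (x : C) : prime x = plus x := by
  by_cases hx : x = ⊤
  · rw [plus, hx, prime_top, pcompl_bot, prime_top]
  · rw [plus, h.prime_eq x hx, pcompl_top, prime_bot]

theorem mem_JIDL1 : C ∈ JIDL1 := by
  refine ⟨fun x y z => ?_, fun x y => ?_, fun x => ?_⟩
  · rcases h.prime_eq_or x with hx | hx <;> rw [hx]
    · simp only [top_sup_eq]
      exact (DQDAlgebra.imp_self_eq _).symm
    · simp only [bot_sup_eq]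
  · rcases h.chain x y with hxy | hxy
    · rw [h.heyting.himp_of_le hxy, top_sup_eq]
    · rw [h.heyting.himp_of_le hxy, sup_top_eq]
  · by_cases hx : x = ⊤
    · simp [levelTerm, iterPrimeStar, hx, prime_top, pcompl_bot]
    · simp [levelTerm, iterPrimeStar, h.prime_eq x hx, pcompl_top]

/-- On these chains all operations are determined by the order and the bounds. -/
theorem isHom_of_strictMono {D : DQDAlg.{v}} (hD : IsDPChain D) {f : C → D} (hf : StrictMono f)
    (hb : f ⊥ = ⊥) (ht : f ⊤ = ⊤) : IsHom f := by
  have hinj : Function.Injective f := by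
    intro x y hxy
    by_contra hne
    rcases h.chain x y with hle | hle
    · exact (hf (lt_of_le_of_ne hle hne)).ne hxy
    · exact (hf (lt_of_le_of_ne hle (Ne.symm hne))).ne hxy.symm
  refine ⟨fun x y => ?_, fun x y => ?_, fun x y => ?_, fun x => ?_, hb, ht⟩
  · rcases h.chain x y with hxy | hxy
    · rw [sup_eq_right.2 hxy, sup_eq_right.2 (hf.monotone hxy)]
    · rw [sup_eq_left.2 hxy, sup_eq_left.2 (hf.monotone hxy)]
  · rcases h.chain x y with hxy | hxy
    · rw [inf_eq_left.2 hxy, inf_eq_left.2 (hf.monotone hxy)]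
    · rw [inf_eq_right.2 hxy, inf_eq_right.2 (hf.monotone hxy)]
  · by_cases hxy : x ≤ y
    · rw [h.heyting.himp_of_le hxy, hD.heyting.himp_of_le (hf.monotone hxy), ht]
    · have hlt : y < x := lt_of_le_not_ge ((h.chain x y).resolve_left hxy) hxy
      rw [h.himp_of_not_le hxy, hD.himp_of_not_le (hf hlt).not_ge]
  · by_cases hx : x = ⊤
    · rw [hx, ht, prime_top, prime_top, hb]
    · rw [h.prime_eq x hx, hD.prime_eq _ (fun e => hx (hinj (e.trans ht.symm))), ht]

theorem lift : IsDPChain (lift.{v} C) where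
  heyting _ _ := funext fun _ => h.heyting _ _
  chain x y := (h.chain (x PUnit.unit) (y PUnit.unit)).imp (fun h _ => h) (fun h _ => h)
  prime_eq _ hx := funext fun _ => h.prime_eq _ fun e => hx (funext fun _ => e)

/-- The linear order of a chain. -/
noncomputable abbrev linearOrder : LinearOrder C :=
  { (inferInstance : Lattice C) with
    le_total := h.chain
    toDecidableLE := Classical.decRel _
    min_def := fun a b => by
      split_ifs with hab
      · exact inf_eq_left.2 hab
      · exact inf_eq_right.2 ((h.chain a b).resolve_left hab)
    max_def := fun a b => by
      split_ifs with hab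
      · exact sup_eq_right.2 hab
      · exact sup_eq_left.2 ((h.chain a b).resolve_left hab) }

end IsDPChain

/-! ### Sizes of chains. -/

theorem exists_strictMono_of_card_le {α : Type u} {β : Type v} [LinearOrder α] [BoundedOrder α]
    [Fintype α] [Nontrivial α] [LinearOrder β] [BoundedOrder β] {T : Finset β}
    (hT : Fintype.card α ≤ T.card) : ∃ f : α → β, StrictMono f ∧ f ⊥ = ⊥ ∧ f ⊤ = ⊤ := by
  have h2 : 1 < Fintype.card α := Fintype.one_lt_card
  -- A subset of the target of size `|α|` containing both bounds exists because `|α| ≥ 2`; the order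
  -- isomorphism onto it must preserve the bounds.
  obtain ⟨U, hU, -, hc⟩ := Finset.exists_subsuperset_card_eq
    (s := {(⊥ : β), ⊤}) (t := T ∪ {⊥, ⊤}) (n := Fintype.card α) Finset.subset_union_right
    (Finset.card_le_two.trans h2) (hT.trans (Finset.card_le_card Finset.subset_union_left))
  let e : α ≃o U := (Fintype.orderIsoFinOfCardEq α rfl).symm.trans (U.orderIsoOfFin hc)
  refine ⟨fun a => e a, fun a b hab => e.strictMono hab, ?_, ?_⟩
  · obtain ⟨a, ha⟩ := e.surjective ⟨⊥, hU (by simp)⟩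
    have h1 : e ⊥ ≤ e a := e.monotone bot_le
    rw [ha] at h1
    exact le_bot_iff.1 h1
  · obtain ⟨a, ha⟩ := e.surjective ⟨⊤, hU (by simp)⟩
    have h1 : e a ≤ e ⊤ := e.monotone le_top
    rw [ha] at h1
    exact top_le_iff.1 h1

theorem finite_of_card_le {α : Type u} {n : ℕ} (h : ∀ S : Finset α, S.card ≤ n) : Finite α := by
  by_contra hinf
  rw [not_finite_iff_infinite] at hinf
  obtain ⟨S, hS⟩ := Infinite.exists_subset_card_eq α (n + 1)
  have := h S
  omega

/-- A nontrivial `C` embeds in `D`. The one-element chain is treated apart, since it embeds in no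
nontrivial algebra. -/
theorem IsVariety.mem_of_card_le {W : Set DQDAlg.{u}} (hW : IsVariety W) {C D : DQDAlg.{u}}
    (hC : IsDPChain C) (hD : IsDPChain D) (hDW : D ∈ W) {n : ℕ} (hn : ∀ S : Finset C, S.card ≤ n)
    {T : Finset D} (hT : n ≤ T.card) : C ∈ W := by
  by_cases hs : ∀ x y : C, x = y
  · exact hW.mem_of_subsingleton hs
  push Not at hs
  have : Nontrivial C := ⟨hs⟩
  have : Finite C := finite_of_card_le hn
  have := Fintype.ofFinite C
  let := hC.linearOrder
  let := hD.linearOrder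
  obtain ⟨f, hf, hb, ht⟩ :=
    exists_strictMono_of_card_le (α := C) (T := T) ((hn Finset.univ).trans hT)
  exact hW.sub D C hDW f (hC.isHom_of_strictMono hD hf hb ht) hf.injective

theorem IsDPChain.card_le_of_satisfiesC {C : DQDAlg.{u}} (h : IsDPChain C) {n : ℕ} (hn : 1 ≤ n)
    (hC : SatisfiesC n C) (T : Finset C) : T.card ≤ n := by
  by_contra! hT
  obtain ⟨S, -, hS⟩ := Finset.exists_subset_card_eq (s := T) (n := n + 1) hT
  let := h.linearOrder
  let e := S.orderEmbOfFin hS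
  have hne : ∀ i : Fin (n + 1), i < Fin.last n → e i ≠ ⊤ := fun i hi =>
    ((e.strictMono hi).trans_le le_top).ne
  have hbt : (⊥ : C) ≠ ⊤ := fun hbt =>
    hne 0 (Fin.lt_def.2 (by simp; omega)) (top_le_iff.1 (hbt ▸ bot_le))
  -- The enumeration is reversed: `x 1 > ⋯ > x n` lie below `x 0`, hence below `⊤`, and each `x i ⇨
  -- x (i + 1)` is just `x (i + 1)`.
  let x : ℕ → C := fun i => e ⟨n - i, by omega⟩
  have hx : ∀ i, 1 ≤ i → x i ≠ ⊤ := fun i hi =>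
    hne _ (Fin.lt_def.2 (by simp; omega))
  have hsup : ∀ (s : Finset ℕ) (y : ℕ → C), (∀ i ∈ s, y i ≠ ⊤) → s.sup y ≠ ⊤ := fun s y hy =>
    Finset.sup_induction (p := fun z => z ≠ ⊤) hbt (fun _ ha _ hb => h.sup_ne_top ha hb) hy
  refine h.sup_ne_top (hsup _ x ?_) (hsup _ _ ?_) (hC x)
  · intro i hi
    exact hx i (Finset.mem_Icc.1 hi).1
  · intro i hi
    rw [Finset.mem_Ico] at hi
    rw [h.himp_of_not_le]
    · exact hx _ (by omega)
    · exact (e.strictMono (Fin.lt_def.2 (by simp; omega))).not_ge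

/-- A failing assignment is strictly decreasing and avoids `⊤`; adding `⊤` gives `n + 1` elements.
-/
theorem IsDPChain.satisfiesC_of_card_le {C : DQDAlg.{u}} (h : IsDPChain C) {n : ℕ}
    (hC : ∀ T : Finset C, T.card ≤ n) : SatisfiesC n C := by
  intro x
  by_contra hne
  have h1 : ∀ i ∈ Finset.Icc 1 n, x i ≠ ⊤ := fun i hi e => hne
    (top_le_iff.1 (e.symm.le.trans ((Finset.le_sup (f := x) hi).trans le_sup_left)))
  have h2 : ∀ i ∈ Finset.Ico 1 n, ¬ x i ≤ x (i + 1) := fun i hi e => hne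
    (top_le_iff.1 ((h.heyting.himp_of_le e).symm.le.trans
      ((Finset.le_sup (f := fun i => x i ⇨ x (i + 1)) hi).trans le_sup_right)))
  let := h.linearOrder
  have h3 : ∀ i, 1 ≤ i → ∀ j, i < j → j ≤ n → x j < x i := by
    intro i hi j hij
    induction j, hij using Nat.le_induction with
    | base => exact fun hj => not_le.1 (h2 i (Finset.mem_Ico.2 ⟨hi, hj⟩))
    | succ j hij ih =>
      intro hj
      exact (not_le.1 (h2 j (Finset.mem_Ico.2 ⟨by omega, by omega⟩))).trans (ih (by omega))
  have hinj : Set.InjOn x (Finset.Icc 1 n : Finset ℕ) := by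
    intro i hi j hj hij
    rw [Finset.mem_coe, Finset.mem_Icc] at hi hj
    rcases lt_trichotomy i j with hlt | rfl | hlt
    · exact absurd hij (h3 i hi.1 j hlt hj.2).ne'
    · rfl
    · exact absurd hij (h3 j hj.1 i hlt hi.2).ne
  have h4 : (⊤ : C) ∉ (Finset.Icc 1 n).image x := by
    intro hm
    obtain ⟨i, hi, he⟩ := Finset.mem_image.1 hm
    exact h1 i hi he
  have h5 := hC (insert ⊤ ((Finset.Icc 1 n).image x))
  rw [Finset.card_insert_of_notMem h4, Finset.card_image_of_injOn hinj] at h5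
  simp at h5

/-! ### Subalgebras and local finiteness of chains -/

/-- Subuniverses. -/
structure IsSubuniverse (A : DQDAlg.{u}) (s : A → Prop) : Prop where
  bot : s ⊥
  top : s ⊤
  sup : ∀ {x y : A}, s x → s y → s (x ⊔ y)
  inf : ∀ {x y : A}, s x → s y → s (x ⊓ y)
  imp : ∀ {x y : A}, s x → s y → s (x ⇨ y)
  prime : ∀ {x : A}, s x → s (prime x)

namespace IsSubuniverse

variable {A : DQDAlg.{u}} {s : A → Prop} (h : IsSubuniverse A s)

/-- The subalgebra on a subuniverse. -/
def subalgebra : DQDAlg.{u} where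
  carrier := Subtype s
  str :=
    { Subtype.lattice (P := s) (fun _ _ => h.sup) (fun _ _ => h.inf) with
      top := ⟨⊤, h.top⟩
      bot := ⟨⊥, h.bot⟩
      le_top := fun x => le_top (a := x.1)
      bot_le := fun x => bot_le (a := x.1)
      himp := fun x y => ⟨x.1 ⇨ y.1, h.imp x.2 y.2⟩
      prime := fun x => ⟨DQDAlg.prime x.1, h.prime x.2⟩
      inf_imp := fun x y => Subtype.ext (DQDAlgebra.inf_imp x.1 y.1)
      inf_imp_eq := fun x y z => Subtype.ext (DQDAlgebra.inf_imp_eq x.1 y.1 z.1)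
      imp_self_eq := fun x => Subtype.ext (DQDAlgebra.imp_self_eq x.1)
      prime_bot := Subtype.ext DQDAlgebra.prime_bot
      prime_top := Subtype.ext DQDAlgebra.prime_top
      prime_inf := fun x y => Subtype.ext (DQDAlgebra.prime_inf x.1 y.1)
      prime_prime_sup := fun x y => Subtype.ext (DQDAlgebra.prime_prime_sup x.1 y.1)
      prime_prime_le := fun x => DQDAlgebra.prime_prime_le x.1 }

/-- The inclusion of a subalgebra. -/
def incl (x : h.subalgebra) : A := Subtype.val x

theorem isHom_incl : IsHom h.incl :=
  ⟨fun _ _ => rfl, fun _ _ => rfl, fun _ _ => rfl, fun _ => rfl, rfl, rfl⟩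

theorem incl_injective : Function.Injective h.incl := Subtype.val_injective

theorem isDPChain (hA : IsDPChain A) : IsDPChain h.subalgebra where
  heyting x y := Subtype.ext (hA.heyting x.1 y.1)
  chain x y := hA.chain x.1 y.1
  prime_eq x hx := Subtype.ext (hA.prime_eq x.1 fun e => hx (Subtype.ext e))

end IsSubuniverse

/-- Every operation returns one of its arguments or a bound. -/
theorem IsDPChain.isSubuniverse {C : DQDAlg.{u}} (h : IsDPChain C) (S : Finset C) :
    IsSubuniverse C fun x => x = ⊥ ∨ x = ⊤ ∨ x ∈ S where
  bot := Or.inl rfl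
  top := Or.inr (Or.inl rfl)
  sup {x y} hx hy := by
    rcases h.chain x y with hxy | hxy
    · rwa [sup_eq_right.2 hxy]
    · rwa [sup_eq_left.2 hxy]
  inf {x y} hx hy := by
    rcases h.chain x y with hxy | hxy
    · rwa [inf_eq_left.2 hxy]
    · rwa [inf_eq_right.2 hxy]
  imp {x y} hx hy := by
    by_cases hxy : x ≤ y
    · exact Or.inr (Or.inl (h.heyting.himp_of_le hxy))
    · rwa [h.himp_of_not_le hxy]
  prime {x} _ := by
    rcases h.prime_eq_or x with hx | hx <;> simp [hx]

/-- A variety with arbitrarily large chains contains all chains. -/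
theorem IsVariety.mem_of_unbounded {W : Set DQDAlg.{u}} (hW : IsVariety W)
    (hn : ∀ n : ℕ, ∃ D ∈ W, IsDPChain D ∧ ∃ T : Finset D, n ≤ T.card)
    {C : DQDAlg.{u}} (hC : IsDPChain C) : C ∈ W := by
  classical
  let B : Finset C → DQDAlg.{u} := fun S => (hC.isSubuniverse S).subalgebra
  let i : ∀ S, B S → C := fun S => (hC.isSubuniverse S).incl
  have hi : ∀ S, IsHom (i S) := fun S => (hC.isSubuniverse S).isHom_incl
  have hB : ∀ S, B S ∈ W := by
    intro S
    obtain ⟨D, hDW, hD, T, hT⟩ := hn ((insert ⊥ (insert ⊤ S) : Finset C).card)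
    refine hW.mem_of_card_le ((hC.isSubuniverse S).isDPChain hC) hD hDW (fun U => ?_) hT
    rw [← Finset.card_image_of_injective U (hC.isSubuniverse S).incl_injective]
    refine Finset.card_le_card fun c hc => ?_
    obtain ⟨x, -, rfl⟩ := Finset.mem_image.1 hc
    simp only [Finset.mem_insert]
    exact x.2
  let P := pi B
  -- Families that are eventually constant along the directed set of finite subsets of `C` form a
  -- subalgebra of the product, and taking limits maps it onto `C`.
  let lim : P → C → Prop := fun x a => ∃ S₀ : Finset C, ∀ S, S₀ ⊆ S → i S (x S) = a
  have hpr : ∀ S, IsHom fun x : P => i S (x S) := fun S => (hi S).comp (isHom_eval B S)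
  have hlim₂ : ∀ (op : P → P → P) (op' : C → C → C),
      (∀ S x y, i S (op x y S) = op' (i S (x S)) (i S (y S))) →
      ∀ {x y a b}, lim x a → lim y b → lim (op x y) (op' a b) := by
    rintro op op' hop x y a b ⟨S, hS⟩ ⟨T, hT⟩
    refine ⟨S ∪ T, fun U hU => ?_⟩
    rw [hop, hS U (Finset.union_subset_left hU), hT U (Finset.union_subset_right hU)]
  have hsup := @hlim₂ (· ⊔ ·) (· ⊔ ·) fun S => (hpr S).map_sup
  have hinf := @hlim₂ (· ⊓ ·) (· ⊓ ·) fun S => (hpr S).map_inf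
  have himp := @hlim₂ (· ⇨ ·) (· ⇨ ·) fun S => (hpr S).map_imp
  have hprime : ∀ {x a}, lim x a → lim (prime x) (prime a) := fun hx =>
    hlim₂ (fun x _ => prime x) (fun x _ => prime x) (fun S x _ => (hpr S).map_prime x) hx hx
  have hbot : lim ⊥ ⊥ := ⟨∅, fun S _ => (hpr S).map_bot⟩
  have htop : lim ⊤ ⊤ := ⟨∅, fun S _ => (hpr S).map_top⟩
  have huniq : ∀ {x a b}, lim x a → lim x b → a = b := by
    rintro x a b ⟨S, hS⟩ ⟨T, hT⟩
    exact (hS (S ∪ T) Finset.subset_union_left).symm.trans (hT _ Finset.subset_union_right)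
  have hE : IsSubuniverse P fun x => ∃ a, lim x a :=
    ⟨⟨⊥, hbot⟩, ⟨⊤, htop⟩, fun ⟨a, ha⟩ ⟨b, hb⟩ => ⟨a ⊔ b, hsup ha hb⟩,
      fun ⟨a, ha⟩ ⟨b, hb⟩ => ⟨a ⊓ b, hinf ha hb⟩, fun ⟨a, ha⟩ ⟨b, hb⟩ => ⟨a ⇨ b, himp ha hb⟩,
      fun ⟨a, ha⟩ => ⟨prime a, hprime ha⟩⟩
  have hEW : hE.subalgebra ∈ W := hW.sub P _ (hW.prod _ B hB) _ hE.isHom_incl hE.incl_injective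
  let f : hE.subalgebra → C := fun x => x.2.choose
  have hf : ∀ x : hE.subalgebra, lim x.1 (f x) := fun x => x.2.choose_spec
  refine hW.image _ C hEW f ⟨fun x y => ?_, fun x y => ?_, fun x y => ?_, fun x => ?_, ?_, ?_⟩ ?_
  · exact huniq (hf (x ⊔ y)) (hsup (hf x) (hf y))
  · exact huniq (hf (x ⊓ y)) (hinf (hf x) (hf y))
  · exact huniq (hf (x ⇨ y)) (himp (hf x) (hf y))
  · exact huniq (hf (prime x)) (hprime (hf x))
  · exact huniq (hf ⊥) hbot
  · exact huniq (hf ⊤) htop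
  · intro a
    have ha : lim (fun S => if h : a ∈ S then ⟨a, Or.inr (Or.inr h)⟩ else ⟨⊥, Or.inl rfl⟩) a := by
      refine ⟨{a}, fun S hS => ?_⟩
      have haS : a ∈ S := hS (Finset.mem_singleton_self a)
      exact congrArg (i S) (dif_pos haS)
    exact ⟨⟨_, a, ha⟩, huniq (hf ⟨_, a, ha⟩) ha⟩

/-! ### The algebras `C_n^dp` and `D₂` -/

theorem isDPChain_chainDP (n : ℕ) [NeZero n] : IsDPChain (chainDP n) where
  heyting x y := if_pos (inf_le_right (a := x) (b := y))
  chain x y := Fin.le_total x y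
  prime_eq _ hx := if_neg hx

theorem exists_finset_lift_chainDP (n : ℕ) [NeZero n] :
    ∃ T : Finset (lift.{u} (chainDP n)), n ≤ T.card := by
  classical
  let f : Fin n → lift.{u} (chainDP n) := fun i _ => i
  have hf : Function.Injective f := fun i j hij => congrFun hij PUnit.unit
  refine ⟨Finset.univ.image f, ?_⟩
  rw [Finset.card_image_of_injective _ hf]
  simp

theorem card_le_lift_chainDP (n : ℕ) [NeZero n] (T : Finset (lift.{u} (chainDP n))) :
    T.card ≤ n := by
  classical
  let f : lift.{u} (chainDP n) → Fin n := fun x => x PUnit.unit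
  have hf : Function.Injective f := fun x y hxy => funext fun _ => hxy
  rw [← Finset.card_image_of_injective T hf]
  exact (Finset.card_le_univ _).trans_eq (Fintype.card_fin n)

theorem IsVariety.lift_chainDP_mem {W : Set DQDAlg.{u}} (hW : IsVariety W) {D : DQDAlg.{u}}
    (hD : IsDPChain D) (hDW : D ∈ W) {n : ℕ} [NeZero n] {T : Finset D} (hT : n ≤ T.card) :
    lift.{u} (chainDP n) ∈ W :=
  hW.mem_of_card_le (isDPChain_chainDP n).lift hD hDW (card_le_lift_chainDP n) hT

theorem IsVariety.mem_of_lift_chainDP_mem {W : Set DQDAlg.{u}} (hW : IsVariety W) {n : ℕ}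
    [NeZero n] (hn : lift.{u} (chainDP n) ∈ W) {C : DQDAlg.{u}} (hC : IsDPChain C)
    (h : ∀ T : Finset C, T.card ≤ n) : C ∈ W := by
  obtain ⟨T, hT⟩ := exists_finset_lift_chainDP.{u} n
  exact hW.mem_of_card_le hC (isDPChain_chainDP n).lift hn h hT

/-- This one Boolean fact gives `D₂` both `(C_n)` for `n ≥ 2` and, at `y = ⊥`, regularity. -/
theorem algD2_sup_himp (x y : algD2) : x ⊔ (x ⇨ y) = ⊤ := by
  obtain ⟨_ | _, _ | _⟩ := x <;> obtain ⟨_ | _, _ | _⟩ := y <;> rfl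

theorem lift_algD2_sup_himp (x y : lift.{u} algD2) : x ⊔ (x ⇨ y) = ⊤ :=
  funext fun _ => algD2_sup_himp _ _

theorem lift_algD2_mem_JIDL1 : lift.{u} algD2 ∈ JIDL1.{u} := by
  have h1 : IsJID algD2 := by
    rintro ⟨_ | _, _ | _⟩ ⟨_ | _, _ | _⟩ ⟨_ | _, _ | _⟩ <;> rfl
  have h2 : IsLinear algD2 := by
    rintro ⟨_ | _, _ | _⟩ ⟨_ | _, _ | _⟩ <;> rfl
  have h3 : HasLevel algD2 1 := by
    rintro ⟨_ | _, _ | _⟩ <;> rfl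
  exact ⟨fun x y z => funext fun _ => h1 _ _ _, fun x y => funext fun _ => h2 _ _,
    fun x => funext fun _ => h3 _⟩

theorem lift_algD2_prime_prime (x : lift.{u} algD2) : prime (prime x) = x := by
  have h : ∀ x : algD2, prime (prime x) = x := by rintro ⟨_ | _, _ | _⟩ <;> rfl
  exact funext fun _ => h _

theorem satisfiesC_lift_algD2 {n : ℕ} (hn : 2 ≤ n) : SatisfiesC n (lift.{u} algD2) := by
  intro x
  rw [← top_le_iff, ← lift_algD2_sup_himp (x 1) (x 2)]
  exact sup_le_sup (Finset.le_sup (f := x) (Finset.mem_Icc.2 ⟨le_rfl, by omega⟩))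
    (Finset.le_sup (f := fun i => x i ⇨ x (i + 1)) (Finset.mem_Ico.2 ⟨le_rfl, by omega⟩))

theorem lift_algD2_sup_prime_ne : ¬ ∀ x : lift.{u} algD2, x ⊔ prime x = ⊤ := by
  intro h
  have h1 : (true, false) = (true, true) := congrFun (h fun _ => (true, false)) PUnit.unit
  simp at h1

theorem lift_algD2_prime_ne_plus : ¬ ∀ x : lift.{u} algD2, prime x = plus x := by
  intro h
  -- At the atom `a` one has `a′ = a`, whereas `a⁺ = a*′ = b′ = b`.
  have h1 : (true, false) = (false, true) := congrFun (h fun _ => (true, false)) PUnit.unit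
  simp at h1

/-- The bounds of `D₂` form a copy of the two-element chain. -/
theorem IsVariety.lift_chainDP_two_mem {W : Set DQDAlg.{u}} (hW : IsVariety W)
    (h : lift.{u} algD2 ∈ W) : lift.{u} (chainDP 2) ∈ W := by
  let f : chainDP 2 → algD2 := fun x : Fin 2 => (decide (x = 1), decide (x = 1))
  have hf : IsHom f := by
    refine ⟨?_, ?_, ?_, ?_, rfl, rfl⟩
    · intro (x : Fin 2) (y : Fin 2); fin_cases x <;> fin_cases y <;> rfl
    · intro (x : Fin 2) (y : Fin 2); fin_cases x <;> fin_cases y <;> rfl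
    · intro (x : Fin 2) (y : Fin 2); fin_cases x <;> fin_cases y <;> rfl
    · intro (x : Fin 2); fin_cases x <;> rfl
  have hi : Function.Injective f := by
    have : ∀ x y : Fin 2, (decide (x = 1), decide (x = 1)) = (decide (y = 1), decide (y = 1)) →
        x = y := by decide
    exact fun x y => this x y
  refine hW.sub _ _ h (fun x _ => f (x PUnit.unit)) (isHom_pi fun _ => hf.comp (isHom_eval _ _))
    fun x y hxy => funext fun _ => hi (congrFun hxy PUnit.unit)

/-! ### Identities on chains -/

theorem IsDPChain.card_le_two {C : DQDAlg.{u}} (h : IsDPChain C)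
    (hp : ∀ x : C, prime (prime x) = x) (T : Finset C) : T.card ≤ 2 := by
  classical
  refine (Finset.card_le_card (t := {⊥, ⊤}) fun x _ => ?_).trans Finset.card_le_two
  have hx := hp x
  rcases h.prime_eq_or x with h1 | h1 <;> rw [h1] at hx
  · simp [← hx, prime_top]
  · simp [← hx, prime_bot]

/-- Here `x′ = 1` for `x ≠ 1` and `y* = 0` for `y ≠ 0`. The order condition leaves at most one
element strictly between the bounds. -/
theorem IsDPChain.inf_prime_le_iff {C : DQDAlg.{u}} (h : IsDPChain C) :
    (∀ x y : C, x ⊓ prime x ≤ y ⊔ pcompl y) ↔ ∀ x y : C, x ≠ ⊤ → y ≠ ⊥ → x ≤ y := by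
  constructor
  · intro hr x y hx hy
    have h1 : pcompl y = ⊥ := h.himp_of_not_le fun e => hy (le_bot_iff.1 e)
    have h2 := hr x y
    rwa [h.prime_eq x hx, inf_top_eq, h1, sup_bot_eq] at h2
  · intro hr x y
    by_cases hx : x = ⊤
    · simp [hx, prime_top]
    by_cases hy : y = ⊥
    · simp [hy, pcompl_bot]
    exact inf_le_left.trans ((hr x y hx hy).trans le_sup_left)

theorem IsDPChain.card_le_three {C : DQDAlg.{u}} (h : IsDPChain C)
    (hr : ∀ x y : C, x ⊓ prime x ≤ y ⊔ pcompl y) (T : Finset C) : T.card ≤ 3 := by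
  classical
  rw [h.inf_prime_le_iff] at hr
  by_cases hm : ∃ m : C, m ≠ ⊥ ∧ m ≠ ⊤
  · obtain ⟨m, hmb, hmt⟩ := hm
    refine (Finset.card_le_card (t := {⊥, ⊤, m}) fun x _ => ?_).trans Finset.card_le_three
    by_cases hxb : x = ⊥
    · simp [hxb]
    by_cases hxt : x = ⊤
    · simp [hxt]
    simp [le_antisymm (hr x m hxt hmb) (hr m x hmt hxb)]
  · push Not at hm
    refine (Finset.card_le_card (t := {⊥, ⊤}) fun x _ => ?_).trans
      (Finset.card_le_two.trans (by norm_num))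
    by_cases hxb : x = ⊥
    · simp [hxb]
    · simp [hm x hxb]

theorem lift_chainDP_three_inf_prime_le (x y : lift.{u} (chainDP 3)) :
    x ⊓ prime x ≤ y ⊔ pcompl y := by
  refine (isDPChain_chainDP 3).lift.inf_prime_le_iff.2 (fun x y hx hy => ?_) x y
  have key : ∀ a b : Fin 3, a ≠ ⊤ → b ≠ ⊥ → a ≤ b := by decide
  exact fun _ => key _ _ (fun e => hx (funext fun _ => e)) fun e => hy (funext fun _ => e)

theorem lift_algD2_le_sup_pcompl (x y : lift.{u} algD2) : x ≤ y ⊔ pcompl y :=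
  le_top.trans_eq (lift_algD2_sup_himp y ⊥).symm

/-! ### The subvarieties -/

theorem join_subset_iff {V : Set DQDAlg.{u}} (hV : IsVariety V) (A B : DQDAlg.{0}) :
    join (generatedBy.{u} A) (generatedBy.{u} B) ⊆ V ↔ lift.{u} A ∈ V ∧ lift.{u} B ∈ V := by
  rw [← generatedBy_subset_iff hV, ← generatedBy_subset_iff hV, ← Set.union_subset_iff]
  exact ⟨(subset_generated _).trans, generated_subset hV⟩

theorem lift_mem_join_left (A B : DQDAlg.{0}) :
    lift.{u} A ∈ join (generatedBy.{u} A) (generatedBy.{u} B) :=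
  subset_generated _ (Or.inl (lift_mem_generatedBy A))

theorem lift_mem_join_right (A B : DQDAlg.{0}) :
    lift.{u} B ∈ join (generatedBy.{u} A) (generatedBy.{u} B) :=
  subset_generated _ (Or.inr (lift_mem_generatedBy B))

/-- Varieties containing `D₂` whose chains have at most `n` elements. -/
theorem IsVariety.eq_join {W : Set DQDAlg.{u}} (hW : IsVariety W) (hWJ : W ⊆ JIDL1) {n : ℕ}
    [NeZero n] (hD : lift.{u} algD2 ∈ W) (hn : lift.{u} (chainDP n) ∈ W)
    (hc : ∀ C ∈ W, IsDPChain C → ∀ T : Finset C, T.card ≤ n) :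
    join (generatedBy.{u} (chainDP n)) (generatedBy.{u} algD2) = W := by
  refine ((join_subset_iff hW _ _).2 ⟨hn, hD⟩).antisymm ?_
  exact hW.subset_of_chains hWJ (isVariety_generated _)
    (fun C hCW hC => (isVariety_generated _).mem_of_lift_chainDP_mem (lift_mem_join_left _ _) hC
      (hc C hCW hC))
    fun _ => lift_mem_join_right _ _

/-- Varieties without `D₂` whose chains have at most `n` elements. -/
theorem IsVariety.eq_generatedBy {W : Set DQDAlg.{u}} (hW : IsVariety W) (hWJ : W ⊆ JIDL1)
    {n : ℕ} [NeZero n] (hD : lift.{u} algD2 ∉ W) (hn : lift.{u} (chainDP n) ∈ W)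
    (hc : ∀ C ∈ W, IsDPChain C → ∀ T : Finset C, T.card ≤ n) :
    generatedBy.{u} (chainDP n) = W := by
  refine ((generatedBy_subset_iff hW _).2 hn).antisymm ?_
  exact hW.subset_of_chains hWJ (isVariety_generated _)
    (fun C hCW hC => (isVariety_generated _).mem_of_lift_chainDP_mem (lift_mem_generatedBy _) hC
      (hc C hCW hC))
    fun h => absurd h hD

/-- In a chain `x′ ∧ x″ = 0` forces `x′ = 0` or `x″ = 0`. The first gives `1 = x″ ≤ x`, the second
`1 = x‴ ≤ x′`. -/
theorem isDPChain_of_isDuallyStone {A : DQDAlg.{u}} (hs : IsDuallyStone A) (hH : IsHeyting A)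
    (hc : IsChainAlg A) : IsDPChain A := by
  refine ⟨hH, hc, fun x hx => ?_⟩
  have h3 : prime (prime (prime x)) ≤ prime x := DQDAlgebra.prime_prime_le (prime x)
  have h0 := hs x
  rcases hc (prime x) (prime (prime x)) with h | h
  · rw [inf_eq_left.2 h] at h0
    have h1 : prime (prime x) ≤ x := DQDAlgebra.prime_prime_le x
    rw [h0, prime_bot] at h1
    exact absurd (top_le_iff.1 h1) hx
  · rw [inf_eq_right.2 h] at h0
    rw [h0, prime_bot] at h3
    exact top_le_iff.1 h3

theorem IsDPChain.isDuallyStone {C : DQDAlg.{u}} (h : IsDPChain C) : IsDuallyStone C := by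
  intro x
  rcases h.prime_eq_or x with hx | hx <;> rw [hx]
  · rw [prime_top, inf_bot_eq]
  · rw [bot_inf_eq]

theorem IsDPChain.mem_DStHC {C : DQDAlg.{u}} (h : IsDPChain C) : C ∈ DStHC :=
  subset_generated _ ⟨h.isDuallyStone, h.heyting, h.chain⟩

theorem DStHC_subset {V : Set DQDAlg.{u}} (hV : IsVariety V) (h : ∀ C, IsDPChain C → C ∈ V) :
    DStHC ⊆ V :=
  generated_subset hV fun A ⟨hs, hH, hc⟩ => h A (isDPChain_of_isDuallyStone hs hH hc)

theorem exists_max_chain {W : Set DQDAlg.{u}} (hW : IsVariety W)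
    (hb : ∃ n, ∀ C ∈ W, IsDPChain C → ∀ T : Finset C, T.card ≤ n) :
    ∃ (n : ℕ) (_ : NeZero n), lift.{u} (chainDP n) ∈ W ∧
      ∀ C ∈ W, IsDPChain C → ∀ T : Finset C, T.card ≤ n := by
  classical
  have h1 : lift.{u} (chainDP 1) ∈ W :=
    hW.mem_of_subsingleton fun _ _ => funext fun _ => Subsingleton.elim (α := Fin 1) _ _
  have hn : ∀ C ∈ W, IsDPChain C → ∀ T : Finset C, T.card ≤ Nat.find hb := Nat.find_spec hb
  obtain ⟨T₁, hT₁⟩ := exists_finset_lift_chainDP.{u} 1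
  have hpos : 1 ≤ Nat.find hb := hT₁.trans (hn _ h1 (isDPChain_chainDP 1).lift T₁)
  have hne : NeZero (Nat.find hb) := ⟨by omega⟩
  -- Since the bound is least, some chain in `W` attains it, so the chain of that size lies in `W`.
  have hmin := Nat.find_min hb (m := Nat.find hb - 1) (by omega)
  push Not at hmin
  obtain ⟨C, hCW, hC, T, hT⟩ := hmin
  exact ⟨Nat.find hb, hne, hW.lift_chainDP_mem hC hCW (T := T) (by omega), hn⟩

/-- Two questions decide the case: whether chain sizes are bounded and whether `D₂` belongs. `V(D₂)`
is the join for `n = 2`, so its own alternative is never selected. -/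
theorem subvariety_cases {W : Set DQDAlg.{u}} (hW : IsVariety W) (hWJ : W ⊆ JIDL1) :
    W = JIDL1.{u} ∨ W = DStHC.{u} ∨ W = generatedBy.{u} algD2 ∨
      (∃ (n : ℕ) (_ : NeZero n), W = generatedBy.{u} (chainDP n)) ∨
      (∃ (n : ℕ) (_ : NeZero n), 2 ≤ n ∧
        W = join (generatedBy.{u} (chainDP n)) (generatedBy.{u} algD2)) := by
  by_cases hb : ∃ n, ∀ C ∈ W, IsDPChain C → ∀ T : Finset C, T.card ≤ n
  · obtain ⟨n, hne, hn, hc⟩ := exists_max_chain hW hb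
    by_cases hD : lift.{u} algD2 ∈ W
    · obtain ⟨T, hT⟩ := exists_finset_lift_chainDP.{u} 2
      have h2 := hc _ (hW.lift_chainDP_two_mem hD) (isDPChain_chainDP 2).lift T
      exact Or.inr (Or.inr (Or.inr (Or.inr
        ⟨n, hne, hT.trans h2, (hW.eq_join hWJ hD hn hc).symm⟩)))
    · exact Or.inr (Or.inr (Or.inr (Or.inl ⟨n, hne, (hW.eq_generatedBy hWJ hD hn hc).symm⟩)))
  · push Not at hb
    have hall : ∀ C : DQDAlg.{u}, IsDPChain C → C ∈ W := fun C hC =>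
      hW.mem_of_unbounded (fun n => by
        obtain ⟨D, hDW, hD, T, hT⟩ := hb n
        exact ⟨D, hDW, hD, T, hT.le⟩) hC
    by_cases hD : lift.{u} algD2 ∈ W
    · exact Or.inl (hWJ.antisymm (isVariety_JIDL1.subset_of_chains Set.Subset.rfl hW
        (fun C _ hC => hall C hC) fun _ => hD))
    · exact Or.inr (Or.inl ((hW.subset_of_chains hWJ (isVariety_generated _)
        (fun C _ hC => hC.mem_DStHC) fun h => absurd h hD).antisymm (DStHC_subset hW hall)))

end DQDAlg

open DQDAlg in
theorem mainTheorem10 :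
    -- `DStHC` is defined, modulo `JIDL₁`, by `x ∨ x′ ≈ 1`
    DStHC.{u} = {A ∈ JIDL1.{u} | ∀ x : A, x ⊔ prime x = ⊤} ∧
    -- `V(D₂)` is defined, modulo `JIDL₁`, by `x″ ≈ x`
    generatedBy.{u} algD2 = {A ∈ JIDL1.{u} | ∀ x : A, prime (prime x) = x} ∧
    -- `V(C_n^dp) ∨ V(D₂)`, `n ≥ 2`, is defined, modulo `JIDL₁`, by `(C_n)`
    (∀ (n : ℕ) [NeZero n], 2 ≤ n →
      join (generatedBy.{u} (chainDP n)) (generatedBy.{u} algD2) =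
        {A ∈ JIDL1.{u} | SatisfiesC n A}) ∧
    -- `V(C_n^dp)`, `n ≥ 1`, is defined, modulo `JIDL₁`, by `x ∨ x′ ≈ 1` and `(C_n)`
    (∀ (n : ℕ) [NeZero n],
      generatedBy.{u} (chainDP n) =
        {A ∈ JIDL1.{u} | (∀ x : A, x ⊔ prime x = ⊤) ∧ SatisfiesC n A}) ∧
    -- every subvariety of `JIDL₁` is `JIDL₁` or one of those above
    (∀ W : Set DQDAlg.{u}, IsVariety W → W ⊆ JIDL1.{u} →
      W = JIDL1.{u} ∨ W = DStHC.{u} ∨ W = generatedBy.{u} algD2 ∨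
      (∃ (n : ℕ) (_ : NeZero n), W = generatedBy.{u} (chainDP n)) ∨
      (∃ (n : ℕ) (_ : NeZero n), 2 ≤ n ∧
        W = join (generatedBy.{u} (chainDP n)) (generatedBy.{u} algD2))) ∧
    -- `V(C₃^dp) ∨ V(D₂)` is defined, modulo `JIDL₁`, by regularity
    join (generatedBy.{u} (chainDP 3)) (generatedBy.{u} algD2) =
      {A ∈ JIDL1.{u} | ∀ x y : A, x ⊓ plus x ≤ y ⊔ pcompl y} ∧
    -- it is also defined, modulo `JIDL₁`, by `x ∧ x′ ≤ y ∨ y*`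
    join (generatedBy.{u} (chainDP 3)) (generatedBy.{u} algD2) =
      {A ∈ JIDL1.{u} | ∀ x y : A, x ⊓ prime x ≤ y ⊔ pcompl y} ∧
    -- `V(C₃^dp)` is defined, modulo `JIDL₁`, by regularity and `x′ ≈ x⁺`
    generatedBy.{u} (chainDP 3) =
      {A ∈ JIDL1.{u} | (∀ x y : A, x ⊓ plus x ≤ y ⊔ pcompl y) ∧ ∀ x : A, prime x = plus x} := by
  have hJ := isVariety_JIDL1.{u}
  have hsat : ∀ (n : ℕ) [NeZero n], SatisfiesC n (lift.{u} (chainDP n)) := fun n _ =>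
    (isDPChain_chainDP n).lift.satisfiesC_of_card_le (card_le_lift_chainDP n)
  have hmem : ∀ (n : ℕ) [NeZero n], lift.{u} (chainDP n) ∈ JIDL1.{u} := fun n _ =>
    (isDPChain_chainDP n).lift.mem_JIDL1
  refine ⟨?_, ?_, fun n _ hn => ?_, fun n _ => ?_, fun W hW hWJ => subvariety_cases hW hWJ,
    ?_, ?_, ?_⟩
  · have hV := hJ.inter isVariety_sup_prime
    refine (DStHC_subset hV fun C hC => ⟨hC.mem_JIDL1, hC.sup_prime⟩).antisymm ?_
    exact hV.subset_of_chains Set.inter_subset_left (isVariety_generated _)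
      (fun C _ hC => hC.mem_DStHC) fun h => absurd h.2 lift_algD2_sup_prime_ne
  · have hV := hJ.inter isVariety_prime_prime
    refine ((generatedBy_subset_iff hV _).2
      ⟨lift_algD2_mem_JIDL1, lift_algD2_prime_prime⟩).antisymm ?_
    have hG : IsVariety (generatedBy.{u} algD2) := isVariety_generated _
    exact hV.subset_of_chains Set.inter_subset_left hG
      (fun C hCV hC => hG.mem_of_lift_chainDP_mem
        (hG.lift_chainDP_two_mem (lift_mem_generatedBy _)) hC (hC.card_le_two hCV.2))
      fun _ => lift_mem_generatedBy _
  · exact (hJ.inter (isVariety_satisfiesC n)).eq_join Set.inter_subset_left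
      ⟨lift_algD2_mem_JIDL1, satisfiesC_lift_algD2 hn⟩ ⟨hmem n, hsat n⟩
      fun C hCV hC => hC.card_le_of_satisfiesC (by omega) hCV.2
  · exact (hJ.inter (isVariety_sup_prime.inter (isVariety_satisfiesC n))).eq_generatedBy
      Set.inter_subset_left (fun h => lift_algD2_sup_prime_ne h.2.1)
      ⟨hmem n, (isDPChain_chainDP n).lift.sup_prime, hsat n⟩
      fun C hCV hC => hC.card_le_of_satisfiesC (NeZero.one_le) hCV.2.2
  -- On chains `x′ = x⁺`, so regularity there means `x ∧ x′ ≤ y ∨ y*`.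
  · refine (hJ.inter isVariety_regular).eq_join Set.inter_subset_left
      ⟨lift_algD2_mem_JIDL1, fun x y => lift_algD2_le_sup_pcompl _ _⟩ ⟨hmem 3, fun x y => ?_⟩
      fun C hCV hC => hC.card_le_three fun x y => ?_
    · rw [← (isDPChain_chainDP 3).lift.prime_eq_plus]
      exact lift_chainDP_three_inf_prime_le x y
    · rw [hC.prime_eq_plus]
      exact hCV.2 x y
  · exact (hJ.inter isVariety_inf_prime_le).eq_join Set.inter_subset_left
      ⟨lift_algD2_mem_JIDL1, fun x y => lift_algD2_le_sup_pcompl _ _⟩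
      ⟨hmem 3, lift_chainDP_three_inf_prime_le⟩ fun C hCV hC => hC.card_le_three hCV.2
  · refine (hJ.inter (isVariety_regular.inter isVariety_prime_eq_plus)).eq_generatedBy
      Set.inter_subset_left (fun h => lift_algD2_prime_ne_plus h.2.2)
      ⟨hmem 3, fun x y => ?_, (isDPChain_chainDP 3).lift.prime_eq_plus⟩
      fun C hCV hC => hC.card_le_three fun x y => ?_
    · rw [← (isDPChain_chainDP 3).lift.prime_eq_plus]
      exact lift_chainDP_three_inf_prime_le x y
    · rw [hC.prime_eq_plus]
      exact hCV.2.1 x y
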